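/- Let $1\le p<\infty$, let $N\ge 2$, and let $\mathcal Z_1,\dots,\mathcal Z_N$ be (non-empty) Polish metric spaces, i.e. complete separable metric spaces, with metrics $\rho_{\mathcal Z_i}$. Finite products are equipped with the $\ell^p$-combination of the metrics of the factors, e.g. $\rho_{\mathcal X\times\mathcal Y}((x_1,y_1),(x_2,y_2))=(\rho_{\mathcal X}(x_1,x_2)^p+\rho_{\mathcal Y}(y_1,y_2)^p)^{1/p}$. For a Polish metric space $\mathcal X$ let $\mathscr P_p(\mathcal X)$ be the set of Borel probability measures $\mu$ on $\mathcal X$ with $\int\rho_{\mathcal X}(x_0,x)^p\,d\mu(x)<\infty$ for some (equivalently every) $x_0$, equipped with the $p$-Wasserstein metric $$\mathcal W_p(\mu,\nu)=\Big(\inf_{\gamma}\int\rho_{\mathcal X}(x_1,x_2)^p\,d\gamma(x_1,x_2)\Big)^{1/p},$$ the infimum being over all couplings $\gamma$ of $\mu$ and $\nu$; $\mathscr P_p(\mathcal X)$ is again a Polish metric space. Put $\overline{\mathcal Z}=\prod_{i=1}^N\mathcal Z_i$, $\overline{\mathcal Z}^t=\prod_{i=1}^t\mathcal Z_i$ and $\overline{\mathcal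 Z}_{t+1}=\prod_{i=t+1}^N\mathcal Z_i$, and let $Z_1,\dots,Z_N$ be the coordinate process on $\overline{\mathcal Z}$. For $1\le t<N$ let $$\mathcal I_t:\mathscr P_p(\overline{\mathcal Z})\to\mathscr P_p\big(\overline{\mathcal Z}^t\times\mathscr P_p(\overline{\mathcal Z}_{t+1})\big)$$ send $\mu$ to the joint law under $\mu$ of $Z_1,\dots,Z_t,\ \mathcal L^\mu(Z_{t+1},\dots,Z_N\mid Z_1,\dots,Z_t)$, where the last entry is the regular conditional law of $(Z_{t+1},\dots,Z_N)$ given $(Z_1,\dots,Z_t)$ under $\mu$. The $\mathcal W_p$-information topology on $\mathscr P_p(\overline{\mathcal Z})$ is the initial topology with respect to the maps $\mathcal I_t$, $1\le t<N$, the target spaces carrying the topology of their $p$-Wasserstein metric. For Polish metric spaces $\mathcal X,\mathcal Y$, a measure $\mu\in\mathscr P_p(\mathcal X\times\mathcal Y)$ and $\delta\ge 0$, the modulus of continuity is $$\omega_\mu(\delta)=\sup_\gamma\Big(\int\rho_{\mathcal Y}(y_1,y_2)^p\,d\gamma(x_1,y_1,x_2,y_2)\Big)^{1/p},$$ the supremum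 being over all subprobability measures $\gamma$ on $\mathcal X\times\mathcal Y\times\mathcal X\times\mathcal Y$ both of whose $\mathcal X\times\mathcal Y$-marginals are $\le\mu$ and for which $\big(\int\rho_{\mathcal X}(x_1,x_2)^p\,d\gamma(x_1,y_1,x_2,y_2)\big)^{1/p}\le\delta$. For $\mathcal I_t(\mu)$ it is taken with $\mathcal X=\overline{\mathcal Z}^t$ and $\mathcal Y=\mathscr P_p(\overline{\mathcal Z}_{t+1})$. **Theorem.** A set $K\subseteq\mathscr P_p(\overline{\mathcal Z})$ is relatively compact in the $\mathcal W_p$-information topology if and only if 1. $K$ is relatively compact in $\mathscr P_p(\overline{\mathcal Z})$ with the topology induced by $\mathcal W_p$, and 2. $\displaystyle\lim_{\delta\searrow 0}\ \sup_{\mu\in K}\omega_{\mathcal I_t(\mu)}(\delta)=0$ for all $t\in\{1,\dots,N-1\}$. -/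

import Mathlib

open MeasureTheory ProbabilityTheory Filter Topology Set
open scoped ENNReal NNReal

noncomputable section

/-- The metric topology of a distance function `edist`: a set is open iff it contains a ball of
positive radius around each of its points. -/
@[reducible] def edistTopology (X : Type*) [EDist X] : TopologicalSpace X where
  IsOpen U := ∀ x ∈ U, ∃ ε : ℝ≥0∞, 0 < ε ∧ ∀ y, edist y x < ε → y ∈ U
  isOpen_univ := fun _ _ => ⟨1, one_pos, fun _ _ => mem_univ _⟩
  isOpen_inter := by
    rintro U V hU hV x ⟨hxU, hxV⟩
    obtain ⟨a, ha, hUa⟩ := hU x hxU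
    obtain ⟨b, hb, hVb⟩ := hV x hxV
    exact ⟨min a b, lt_min ha hb, fun y hy =>
      ⟨hUa y (hy.trans_le (min_le_left _ _)), hVb y (hy.trans_le (min_le_right _ _))⟩⟩
  isOpen_sUnion := by
    rintro S hS x ⟨U, hU, hx⟩
    obtain ⟨a, ha, h⟩ := hS U hU x hx
    exact ⟨a, ha, fun y hy => ⟨U, hU, h y hy⟩⟩

/-- `μ` has a finite `p`-th moment. -/
def HasFiniteMoment (p : ℝ≥0∞) {X : Type*} [EDist X] [MeasurableSpace X] (μ : Measure X) : Prop :=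
  ∃ x₀ : X, ∫⁻ x, edist x₀ x ^ p.toReal ∂μ < ∞

/-- The space `𝒫_p(X)` of probability measures on `X` with finite `p`-th moment. -/
def PSpace (p : ℝ≥0∞) (X : Type*) [EDist X] [MeasurableSpace X] : Type _ :=
  {μ : ProbabilityMeasure X // HasFiniteMoment p (μ : Measure X)}

namespace PSpace

variable {p : ℝ≥0∞} {X : Type*} [EDist X] [MeasurableSpace X]

/-- The underlying measure. -/
def toMeasure (μ : PSpace p X) : Measure X := (μ.1 : Measure X)

instance (μ : PSpace p X) : IsProbabilityMeasure μ.toMeasure :=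
  inferInstanceAs (IsProbabilityMeasure (μ.1 : Measure X))

/-- The `p`-Wasserstein distance `𝒲_p`: the infimum, over all couplings `γ` of `μ` and `ν`, of
`(∫ ρ(x₁, x₂)^p dγ(x₁, x₂))^(1/p)`. -/
instance : EDist (PSpace p X) where
  edist μ ν :=
    (⨅ γ ∈ {γ : Measure (X × X) | γ.map Prod.fst = μ.toMeasure ∧ γ.map Prod.snd = ν.toMeasure},
      ∫⁻ z, edist z.1 z.2 ^ p.toReal ∂γ) ^ (1 / p.toReal)

/-- The topology induced by the `p`-Wasserstein distance. -/
instance : TopologicalSpace (PSpace p X) := edistTopology (PSpace p X)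

/-- The `σ`-algebra generated by the evaluations `μ ↦ μ(B)`, `B` measurable. If `X` is a Polish
metric space with its Borel `σ`-algebra and `1 ≤ p < ∞`, this is the Borel `σ`-algebra of `𝒲_p`. -/
instance : MeasurableSpace (PSpace p X) :=
  MeasurableSpace.comap toMeasure inferInstance

end PSpace

/-- The point mass at `x`. -/
def PSpace.dirac {X : Type*} [EMetricSpace X] [MeasurableSpace X] [BorelSpace X]
    (p : ℝ≥0∞) (x : X) : PSpace p X :=
  ⟨⟨Measure.dirac x, inferInstance⟩, x, by
    simp only [ProbabilityMeasure.coe_mk, lintegral_dirac, edist_self]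
    exact ENNReal.rpow_lt_top_of_nonneg ENNReal.toReal_nonneg ENNReal.zero_ne_top⟩

/-- A point mass can be coupled with any other measure by the product coupling. -/
theorem PSpace.edist_dirac_le {X : Type*} [EMetricSpace X] [MeasurableSpace X] [BorelSpace X]
    {p : ℝ≥0∞} (hp : 0 < p.toReal) (x : X) (ν : PSpace p X) :
    edist (PSpace.dirac p x) ν ^ p.toReal ≤ ∫⁻ y, edist x y ^ p.toReal ∂ν.toMeasure := by
  have h : edist (PSpace.dirac p x) ν = (⨅ γ ∈ {γ : Measure (X × X) |
      γ.map Prod.fst = (PSpace.dirac p x).toMeasure ∧ γ.map Prod.snd = ν.toMeasure},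
      ∫⁻ z, edist z.1 z.2 ^ p.toReal ∂γ) ^ (1 / p.toReal) := rfl
  rw [h, ← ENNReal.rpow_mul, one_div_mul_cancel hp.ne', ENNReal.rpow_one]
  refine (iInf₂_le (ν.toMeasure.map (Prod.mk x)) ⟨?_, ?_⟩).trans (lintegral_map_le _ _)
  · rw [Measure.map_map measurable_fst measurable_prodMk_left]
    change ν.toMeasure.map (fun _ => x) = Measure.dirac x
    simp
  · rw [Measure.map_map measurable_snd measurable_prodMk_left]
    exact Measure.map_id

theorem hasFiniteMoment_iff {p : ℝ≥0∞} [Fact (1 ≤ p)] {X : Type*} [MetricSpace X]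
    [MeasurableSpace X]
    {μ : Measure X} [IsProbabilityMeasure μ] (x : X) :
    HasFiniteMoment p μ ↔ ∫⁻ y, edist x y ^ p.toReal ∂μ < ∞ := by
  refine ⟨fun ⟨a, ha⟩ => ?_, fun h => ⟨x, h⟩⟩
  rcases eq_or_ne p ∞ with rfl | hp
  · simp
  have hq : 1 ≤ p.toReal := by
    rw [← ENNReal.toReal_one]
    exact ENNReal.toReal_mono hp Fact.out
  have hle : ∀ y, edist x y ^ p.toReal ≤
      2 ^ (p.toReal - 1) * (edist x a ^ p.toReal + edist a y ^ p.toReal) := fun y =>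
    (ENNReal.rpow_le_rpow (edist_triangle x a y) (by positivity)).trans
      (ENNReal.rpow_add_le_mul_rpow_add_rpow _ _ hq)
  refine (lintegral_mono hle).trans_lt ?_
  have h2 : (2 : ℝ≥0∞) ^ (p.toReal - 1) ≠ ∞ :=
    (ENNReal.rpow_lt_top_of_nonneg (by linarith) (by simp)).ne
  rw [lintegral_const_mul' _ _ h2, lintegral_add_left measurable_const, lintegral_const]
  refine ENNReal.mul_lt_top h2.lt_top (ENNReal.add_lt_top.2 ⟨?_, ha⟩)
  simpa using ENNReal.rpow_lt_top_of_nonneg (by positivity) (edist_ne_top x a)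

section Modulus

variable {X Y : Type*} [EDist X] [EDist Y] [MeasurableSpace X] [MeasurableSpace Y]

/-- `ρ^X(γ) = (∫ ρ_X(x₁, x₂)^p dγ(x₁, y₁, x₂, y₂))^(1/p)`. -/
def shiftFst (p : ℝ≥0∞) (γ : Measure (WithLp p (X × Y) × WithLp p (X × Y))) : ℝ≥0∞ :=
  (∫⁻ z, edist z.1.fst z.2.fst ^ p.toReal ∂γ) ^ (1 / p.toReal)

/-- `ρ^Y(γ) = (∫ ρ_Y(y₁, y₂)^p dγ(x₁, y₁, x₂, y₂))^(1/p)`. -/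
def shiftSnd (p : ℝ≥0∞) (γ : Measure (WithLp p (X × Y) × WithLp p (X × Y))) : ℝ≥0∞ :=
  (∫⁻ z, edist z.1.snd z.2.snd ^ p.toReal ∂γ) ^ (1 / p.toReal)

/-- The subprobabilities `γ` both of whose `X × Y`-marginals are `≤ μ` and which satisfy
`ρ^X(γ) ≤ δ`. -/
def shifts {p : ℝ≥0∞} (μ : PSpace p (WithLp p (X × Y))) (δ : ℝ≥0) :
    Set (Measure (WithLp p (X × Y) × WithLp p (X × Y))) :=
  {γ | γ univ ≤ 1 ∧ γ.map Prod.fst ≤ μ.toMeasure ∧ γ.map Prod.snd ≤ μ.toMeasure ∧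
    shiftFst p γ ≤ δ}

/-- The modulus of continuity `ω_μ(δ)` of `μ ∈ 𝒫_p(X × Y)`. -/
def modulus {p : ℝ≥0∞} (μ : PSpace p (WithLp p (X × Y))) (δ : ℝ≥0) : ℝ≥0∞ :=
  ⨆ γ ∈ shifts μ δ, shiftSnd p γ

end Modulus

section Information

variable {N : ℕ} (p : ℝ≥0∞) (Z : Fin N → Type*)

/-- The product of the first `t` of the `N` spaces, with the `ℓ^p`-metric. -/
abbrev Past (t : ℕ) : Type _ := PiLp p (fun i : {i : Fin N // i.val < t} => Z i.val)

/-- The product of the last `N - t` of the `N` spaces, with the `ℓ^p`-metric. -/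
abbrev Future (t : ℕ) : Type _ := PiLp p (fun i : {i : Fin N // t ≤ i.val} => Z i.val)

variable {p Z}

/-- The first `t` coordinates. -/
def past (t : ℕ) (z : PiLp p Z) : Past p Z t := WithLp.toLp p fun i => z i.val

/-- The coordinates after the first `t`. -/
def future (t : ℕ) (z : PiLp p Z) : Future p Z t := WithLp.toLp p fun i => z i.val

theorem measurable_past [∀ i, MeasurableSpace (Z i)] (t : ℕ) :
    Measurable (past (p := p) (Z := Z) t) := by
  unfold past
  fun_prop

theorem measurable_future [∀ i, MeasurableSpace (Z i)] (t : ℕ) :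
    Measurable (future (p := p) (Z := Z) t) := by
  unfold future
  fun_prop

theorem edist_restrict_le [∀ i, EDist (Z i)] (hp : 0 < p.toReal) (P : Fin N → Prop)
    [DecidablePred P] (w z : PiLp p Z) :
    edist (WithLp.toLp p fun i : {i // P i} => w i.val : PiLp p fun i : {i // P i} => Z i.val)
      (WithLp.toLp p fun i : {i // P i} => z i.val) ≤ edist w z := by
  rw [PiLp.edist_eq_sum hp, PiLp.edist_eq_sum hp]
  refine ENNReal.rpow_le_rpow ?_ (by positivity)
  rw [← Finset.sum_subtype (Finset.univ.filter P) (by simp)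
    (fun i => edist (w i) (z i) ^ p.toReal)]
  exact Finset.sum_le_sum_of_subset (Finset.filter_subset _ _)

variable [Fact (1 ≤ p)] [∀ i, MetricSpace (Z i)] [∀ i, CompleteSpace (Z i)]
  [∀ i, SecondCountableTopology (Z i)] [∀ i, MeasurableSpace (Z i)] [∀ i, BorelSpace (Z i)]
  [∀ i, Nonempty (Z i)]

instance (t : ℕ) : Nonempty (Future p Z t) :=
  (WithLp.equiv p _).nonempty

open Classical in
/-- The conditional law under `μ` of the coordinates after the first `t` given the first `t`.
For almost all values of the first `t` coordinates it has a finite `p`-th moment; on the exceptional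
null set it is given an arbitrary value. -/
def condLaw (t : ℕ) (μ : PSpace p (PiLp p Z)) (x : Past p Z t) : PSpace p (Future p Z t) :=
  if h : HasFiniteMoment p (condDistrib (future t) (past t) μ.toMeasure x) then
    ⟨⟨condDistrib (future t) (past t) μ.toMeasure x, inferInstance⟩, h⟩
  else PSpace.dirac p (Classical.arbitrary _)

theorem toMeasure_condLaw_of_pos {t : ℕ} {μ : PSpace p (PiLp p Z)} {x : Past p Z t}
    (h : HasFiniteMoment p (condDistrib (future t) (past t) μ.toMeasure x)) :
    (condLaw t μ x).toMeasure = condDistrib (future t) (past t) μ.toMeasure x :=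
  congrArg PSpace.toMeasure (dif_pos h)

theorem toMeasure_condLaw_of_neg {t : ℕ} {μ : PSpace p (PiLp p Z)} {x : Past p Z t}
    (h : ¬ HasFiniteMoment p (condDistrib (future t) (past t) μ.toMeasure x)) :
    (condLaw t μ x).toMeasure = Measure.dirac (Classical.arbitrary _) :=
  congrArg PSpace.toMeasure (dif_neg h)

theorem measurable_condLaw (t : ℕ) (μ : PSpace p (PiLp p Z)) : Measurable (condLaw t μ) := by
  classical
  refine measurable_comap_iff.2 ?_
  let κ := condDistrib (future t) (past t) μ.toMeasure
  let y₀ : Future p Z t := Classical.arbitrary _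
  have h : PSpace.toMeasure ∘ condLaw t μ = fun x =>
      if ∫⁻ y, edist y₀ y ^ p.toReal ∂(κ x) < ∞ then κ x else Measure.dirac y₀ := by
    funext x
    simp only [Function.comp_apply, ← hasFiniteMoment_iff y₀]
    split_ifs with h
    · exact toMeasure_condLaw_of_pos h
    · exact toMeasure_condLaw_of_neg h
  rw [h]
  refine Measurable.ite (measurableSet_lt ?_ measurable_const) κ.measurable measurable_const
  exact (Measure.measurable_lintegral (by fun_prop)).comp κ.measurable

/-- The pair consisting of the first `t` coordinates and the conditional law, given these, of the
remaining coordinates under `μ`. -/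
def pastAndCondLaw (t : ℕ) (μ : PSpace p (PiLp p Z)) (z : PiLp p Z) :
    WithLp p (Past p Z t × PSpace p (Future p Z t)) :=
  WithLp.toLp p (past t z, condLaw t μ (past t z))

theorem measurable_pastAndCondLaw (t : ℕ) (μ : PSpace p (PiLp p Z)) :
    Measurable (pastAndCondLaw t μ) :=
  (WithLp.measurable_toLp _ _).comp
    ((measurable_past t).prodMk ((measurable_condLaw t μ).comp (measurable_past t)))

theorem hasFiniteMoment_map_pastAndCondLaw (t : ℕ) (μ : PSpace p (PiLp p Z)) :
    HasFiniteMoment p (μ.toMeasure.map (pastAndCondLaw t μ)) := by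
  obtain ⟨w, hw⟩ := μ.2
  change ∫⁻ z, edist w z ^ p.toReal ∂μ.toMeasure < ∞ at hw
  refine ⟨WithLp.toLp p (past t w, PSpace.dirac p (future t w)), ?_⟩
  refine (lintegral_map_le _ _).trans_lt ?_
  rcases eq_or_ne p ∞ with rfl | hp
  · simp
  have hq : 0 < p.toReal :=
    ENNReal.toReal_pos (zero_lt_one.trans_le (Fact.out : 1 ≤ p)).ne' hp
  let κ := condDistrib (future t) (past t) μ.toMeasure
  let f : Future p Z t → ℝ≥0∞ := fun y => edist (future t w) y ^ p.toReal
  have hf : Measurable f := by fun_prop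
  have hcond : ∀ x, edist (PSpace.dirac p (future t w)) (condLaw t μ x) ^ p.toReal ≤
      ∫⁻ y, f y ∂(κ x) := by
    intro x
    by_cases h : HasFiniteMoment p (κ x)
    · refine (PSpace.edist_dirac_le hq _ _).trans_eq ?_
      rw [toMeasure_condLaw_of_pos h]
    · rw [hasFiniteMoment_iff (future t w), not_lt, top_le_iff] at h
      exact le_top.trans_eq h.symm
  have hint : ∫⁻ z, ∫⁻ y, f y ∂(κ (past t z)) ∂μ.toMeasure
      = ∫⁻ z, f (future t z) ∂μ.toMeasure := by
    rw [← lintegral_map (f := fun x => ∫⁻ y, f y ∂(κ x)) hf.lintegral_kernel (measurable_past t),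
      ← Measure.lintegral_bind κ.aemeasurable hf.aemeasurable,
      condDistrib_comp_map (measurable_past t).aemeasurable (measurable_future t).aemeasurable,
      lintegral_map hf (measurable_future t)]
  have hpast : ∀ z, edist (past t w) (past t z) ≤ edist w z := fun z =>
    edist_restrict_le hq (fun i => i.val < t) w z
  have hfut : ∀ z, edist (future t w) (future t z) ≤ edist w z := fun z =>
    edist_restrict_le hq (fun i => t ≤ i.val) w z
  calc ∫⁻ z, edist (WithLp.toLp p (past t w, PSpace.dirac p (future t w)))
        (pastAndCondLaw t μ z) ^ p.toReal ∂μ.toMeasure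
      ≤ ∫⁻ z, (edist w z ^ p.toReal + ∫⁻ y, f y ∂(κ (past t z))) ∂μ.toMeasure := by
        refine lintegral_mono fun z => ?_
        rw [WithLp.prod_edist_eq_add hq, ← ENNReal.rpow_mul, one_div_mul_cancel hq.ne',
          ENNReal.rpow_one]
        exact add_le_add (ENNReal.rpow_le_rpow (hpast z) hq.le) (hcond _)
    _ = ∫⁻ z, edist w z ^ p.toReal ∂μ.toMeasure + ∫⁻ z, f (future t z) ∂μ.toMeasure := by
        rw [lintegral_add_left (by fun_prop), hint]
    _ ≤ ∫⁻ z, edist w z ^ p.toReal ∂μ.toMeasure + ∫⁻ z, edist w z ^ p.toReal ∂μ.toMeasure := by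
        gcongr with z
        exact ENNReal.rpow_le_rpow (hfut z) hq.le
    _ < ∞ := ENNReal.add_lt_top.2 ⟨hw, hw⟩

/-- `ℐ_t(μ)`: the joint law under `μ` of the first `t` coordinates and the conditional law of the
remaining coordinates given these. -/
def infoMap (t : ℕ) (μ : PSpace p (PiLp p Z)) :
    PSpace p (WithLp p (Past p Z t × PSpace p (Future p Z t))) :=
  ⟨⟨μ.toMeasure.map (pastAndCondLaw t μ),
    Measure.isProbabilityMeasure_map (measurable_pastAndCondLaw t μ).aemeasurable⟩,
    hasFiniteMoment_map_pastAndCondLaw t μ⟩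

variable (p Z) in
/-- The `𝒲_p`-information topology on `𝒫_p(Z_1 × ⋯ × Z_N)`: the initial topology with respect to
the maps `ℐ_t`, `1 ≤ t < N`. -/
@[reducible] def infoTopology : TopologicalSpace (PSpace p (PiLp p Z)) :=
  ⨅ t ∈ Ico 1 N, TopologicalSpace.induced (infoMap t) inferInstance

end Information

end

/-!
The intensity of a law `P` of a past and a law of the future, obtained by
drawing the future from the second coordinate of `P`, depends continuously on `P` and is a left
inverse of `ℐ_t` (`intensity_infoMap`). So the information topology is finer than that of `𝒲_p`, and
a set is relatively compact in it as soon as its joint image under the maps `ℐ_t` is relatively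
compact and all limits of this image lie in the range (`Topology.IsInducing.isCompact_closure`).

Relative compactness of the image holds for every `𝒲_p`-relatively compact `K`, without any
condition on moduli (`isCompact_closure_image_infoMap`). Since `𝒲_p`-convergence is weak
convergence together with convergence of the `p`-th moments (`PSpace.tendsto_nhds_iff`), relative
compactness in `𝒫_p` amounts to a bound for the integrals of a function `Φ` with compact sublevel
sets which grows faster than the `p`-th power of the distance (`IsMomentCoercive`). If `Φ` is such a
function, then so is `μ ↦ ∫ Φ dμ` on `𝒫_p`. This turns coercive functions for the laws of the past
and of the future under `μ ∈ K` into one for the laws `ℐ_t(μ)`, with the same bounds by the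
disintegration formula (`lintegral_infoMap_lintegral`).

The modulus of continuity decides whether limits lie in the range. It vanishes at `δ = 0` precisely
if the second coordinate is a function of the first one, which for laws on pasts and laws of the
future means that the law is the image under `ℐ_t` of its intensity
(`infoMap_intensity_of_modulus_zero`). In this case it also tends to `0` as `δ ↘ 0`
(`exists_modulus_le_of_ae_eq`), because an `L^p` function can be approximated by bounded continuous
ones. Gluing a coupling to both ends of a shift shows the semicontinuity
`ω_Q(δ) ≤ ω_P(δ + 2ε) + 2ε` for `𝒲_p(Q, P) < ε` (`modulus_le_of_edist_lt`). On the one hand, uniformly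
small moduli therefore force `ω_P(0) = 0` for all limits `P`, and the intensities of the components
of a limit agree by continuity, so that the limit lies in the range. On the other hand, the moduli
tend to `0` uniformly on compact sets of laws of the form `ℐ_t(μ)`, by a Dini argument
(`IsCompact.exists_forall_modulus_le`).
-/

set_option linter.unusedSectionVars false

noncomputable section

/-! ### `L^p` seminorms of extended nonnegative functions -/

theorem one_le_toReal_of_fact (p : ℝ≥0∞) [h1 : Fact (1 ≤ p)] [hp : Fact (p ≠ ∞)] :
    1 ≤ p.toReal := by
  rw [← ENNReal.toReal_one]
  exact ENNReal.toReal_mono hp.out h1.out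

theorem toReal_pos_of_fact (p : ℝ≥0∞) [Fact (1 ≤ p)] [Fact (p ≠ ∞)] : 0 < p.toReal :=
  zero_lt_one.trans_le (one_le_toReal_of_fact p)

/-- The `L^p` seminorm `(∫ f^p dγ)^(1/p)` of a function with values in `[0, ∞]`. -/
def lpSize (p : ℝ≥0∞) {Ω : Type*} [MeasurableSpace Ω] (f : Ω → ℝ≥0∞) (γ : Measure Ω) : ℝ≥0∞ :=
  (∫⁻ ω, f ω ^ p.toReal ∂γ) ^ (1 / p.toReal)

section LpSize

variable {p : ℝ≥0∞} {Ω Ω' : Type*} [MeasurableSpace Ω] [MeasurableSpace Ω']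
  {f g : Ω → ℝ≥0∞} {γ γ' : Measure Ω}

theorem lpSize_mono (h : ∀ ω, f ω ≤ g ω) : lpSize p f γ ≤ lpSize p g γ := by
  unfold lpSize
  gcongr with ω
  exact h ω

theorem lpSize_mono_ae (h : ∀ᵐ ω ∂γ, f ω ≤ g ω) : lpSize p f γ ≤ lpSize p g γ := by
  unfold lpSize
  gcongr ?_ ^ _
  refine lintegral_mono_ae ?_
  filter_upwards [h] with ω hω
  gcongr

theorem lpSize_mono_measure (h : γ ≤ γ') : lpSize p f γ ≤ lpSize p f γ' := by
  unfold lpSize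
  gcongr

theorem lpSize_map {f : Ω' → ℝ≥0∞} {g : Ω → Ω'} (hf : Measurable f) (hg : Measurable g) :
    lpSize p f (γ.map g) = lpSize p (fun ω => f (g ω)) γ := by
  unfold lpSize
  rw [lintegral_map (by fun_prop) hg]

variable [Fact (1 ≤ p)] [Fact (p ≠ ∞)]

theorem lpSize_rpow : lpSize p f γ ^ p.toReal = ∫⁻ ω, f ω ^ p.toReal ∂γ := by
  unfold lpSize
  rw [← ENNReal.rpow_mul, one_div_mul_cancel (toReal_pos_of_fact p).ne', ENNReal.rpow_one]

theorem lpSize_le_iff {c : ℝ≥0∞} :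
    lpSize p f γ ≤ c ↔ ∫⁻ ω, f ω ^ p.toReal ∂γ ≤ c ^ p.toReal := by
  rw [← lpSize_rpow, ENNReal.rpow_le_rpow_iff (toReal_pos_of_fact p)]

theorem lpSize_add_le (hf : AEMeasurable f γ) (hg : AEMeasurable g γ) :
    lpSize p (fun ω => f ω + g ω) γ ≤ lpSize p f γ + lpSize p g γ :=
  ENNReal.lintegral_Lp_add_le hf hg (one_le_toReal_of_fact p)

theorem lpSize_add_three_le {h : Ω → ℝ≥0∞} (hf : AEMeasurable f γ) (hg : AEMeasurable g γ)
    (hh : AEMeasurable h γ) :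
    lpSize p (fun ω => f ω + g ω + h ω) γ ≤ lpSize p f γ + lpSize p g γ + lpSize p h γ :=
  (lpSize_add_le (hf.add hg) hh).trans (by gcongr; exact lpSize_add_le hf hg)

theorem lpSize_const_le (hγ : γ univ ≤ 1) (c : ℝ≥0∞) : lpSize p (fun _ => c) γ ≤ c := by
  rw [lpSize_le_iff, lintegral_const]
  exact mul_le_of_le_one_right' hγ

/-- Hölder's inequality against the constant one. -/
theorem lintegral_le_lpSize [IsProbabilityMeasure γ] (hf : AEMeasurable f γ) :
    ∫⁻ ω, f ω ∂γ ≤ lpSize p f γ := by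
  rcases (one_le_toReal_of_fact p).eq_or_lt with h | h
  · simp [lpSize, ← h]
  · have := ENNReal.lintegral_mul_le_Lp_mul_Lq γ (Real.HolderConjugate.conjExponent h) hf
      (aemeasurable_const (b := 1))
    simpa [lpSize] using this

/-- Convexity of `t ↦ t^p`, applied to the triangle inequality through a base point. -/
theorem edist_rpow_le_two_mul {X : Type*} [PseudoEMetricSpace X] (x y z : X) :
    edist y z ^ p.toReal ≤ 2 ^ (p.toReal - 1) * (edist x y ^ p.toReal + edist x z ^ p.toReal) :=
  (ENNReal.rpow_le_rpow (edist_triangle_left y z x) (toReal_pos_of_fact p).le).trans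
    (ENNReal.rpow_add_le_mul_rpow_add_rpow _ _ (one_le_toReal_of_fact p))

end LpSize

/-! ### Couplings and gluing -/

/-- `γ` is a coupling of `μ` and `ν`. -/
structure IsCoupling {X : Type*} [MeasurableSpace X] (γ : Measure (X × X)) (μ ν : Measure X) :
    Prop where
  map_fst : γ.map Prod.fst = μ
  map_snd : γ.map Prod.snd = ν

namespace IsCoupling

variable {X : Type*} [MeasurableSpace X] {γ : Measure (X × X)} {μ ν : Measure X}

theorem isProbabilityMeasure [IsProbabilityMeasure μ] (h : IsCoupling γ μ ν) :
    IsProbabilityMeasure γ := by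
  constructor
  have := congrArg (fun m => m univ) h.map_fst
  simpa [Measure.map_apply measurable_fst MeasurableSet.univ] using this

theorem swap (h : IsCoupling γ μ ν) : IsCoupling (γ.map Prod.swap) ν μ := by
  constructor
  · rw [Measure.map_map measurable_fst measurable_swap]; exact h.map_snd
  · rw [Measure.map_map measurable_snd measurable_swap]; exact h.map_fst

end IsCoupling

theorem isCoupling_diag {X : Type*} [MeasurableSpace X] (μ : Measure X) :
    IsCoupling (μ.map fun x => (x, x)) μ μ := by
  constructor
  · rw [Measure.map_map measurable_fst (by fun_prop)]; exact Measure.map_id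
  · rw [Measure.map_map measurable_snd (by fun_prop)]; exact Measure.map_id

theorem compProd_mono_left {α β : Type*} [MeasurableSpace α] [MeasurableSpace β]
    {μ ν : Measure α} [SFinite μ] [SFinite ν] (h : μ ≤ ν) (κ : Kernel α β) [IsSFiniteKernel κ] :
    μ ⊗ₘ κ ≤ ν ⊗ₘ κ := by
  refine Measure.le_iff.2 fun s hs => ?_
  rw [Measure.compProd_apply hs, Measure.compProd_apply hs]
  exact lintegral_mono' h le_rfl

theorem map_compProd_comap {Ω X Y : Type*} [MeasurableSpace Ω] [MeasurableSpace X]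
    [MeasurableSpace Y] (m : Measure Ω) [IsFiniteMeasure m] {f : Ω → X} (hf : Measurable f)
    (κ : Kernel X Y) [IsSFiniteKernel κ] :
    (m ⊗ₘ κ.comap f hf).map (fun ω => (f ω.1, ω.2)) = (m.map f) ⊗ₘ κ := by
  ext s hs
  rw [Measure.map_apply (by fun_prop) hs, Measure.compProd_apply (by measurability),
    Measure.compProd_apply hs, lintegral_map (Kernel.measurable_kernel_prodMk_left hs) hf]
  rfl

/-- **Gluing.** If the law of `f` under `m` is dominated by the first marginal of `π`, then `m` can
be enlarged by a further coordinate in such a way that the joint law of `f` and this coordinate is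
dominated by `π`, with equality if the law of `f` is the first marginal of `π`. -/
theorem exists_glue {Ω X Y : Type*} [MeasurableSpace Ω] [MeasurableSpace X] [MeasurableSpace Y]
    [StandardBorelSpace Y] [Nonempty Y] (m : Measure Ω) [IsFiniteMeasure m] {f : Ω → X}
    (hf : Measurable f) (π : Measure (X × Y)) [IsFiniteMeasure π] (h : m.map f ≤ π.map Prod.fst) :
    ∃ θ : Measure (Ω × Y), θ.map Prod.fst = m ∧ θ.map (fun ω => (f ω.1, ω.2)) ≤ π ∧
      (m.map f = π.map Prod.fst → θ.map (fun ω => (f ω.1, ω.2)) = π) := by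
  refine ⟨m ⊗ₘ π.condKernel.comap f hf, Measure.fst_compProd _ _, ?_, fun h' => ?_⟩
  · rw [map_compProd_comap]
    conv_rhs => rw [← π.disintegrate π.condKernel]
    exact compProd_mono_left h _
  · rw [map_compProd_comap, h']
    exact π.disintegrate π.condKernel

/-! ### The Wasserstein metric -/

namespace PSpace

section General

variable {p : ℝ≥0∞} {X : Type*} [MeasurableSpace X]

@[ext]
theorem ext [EDist X] {μ ν : PSpace p X} (h : μ.toMeasure = ν.toMeasure) : μ = ν :=
  Subtype.ext (Subtype.ext h)

variable [Fact (1 ≤ p)] [Fact (p ≠ ∞)]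

theorem edist_le_of_isCoupling [EDist X] {μ ν : PSpace p X} {γ : Measure (X × X)}
    (h : IsCoupling γ μ.toMeasure ν.toMeasure) :
    edist μ ν ≤ lpSize p (fun z => edist z.1 z.2) γ :=
  ENNReal.rpow_le_rpow (iInf₂_le γ ⟨h.map_fst, h.map_snd⟩) (by positivity)

theorem exists_isCoupling_lt [EDist X] {μ ν : PSpace p X} {ε : ℝ≥0∞} (h : edist μ ν < ε) :
    ∃ γ, IsCoupling γ μ.toMeasure ν.toMeasure ∧ lpSize p (fun z => edist z.1 z.2) γ < ε := by
  have hq := toReal_pos_of_fact p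
  change (⨅ γ ∈ _, _) ^ (1 / p.toReal) < ε at h
  rw [one_div, ENNReal.rpow_inv_lt_iff hq] at h
  simp only [iInf_lt_iff] at h
  obtain ⟨γ, hγ, hlt⟩ := h
  refine ⟨γ, ⟨hγ.1, hγ.2⟩, ?_⟩
  unfold lpSize
  rwa [one_div, ENNReal.rpow_inv_lt_iff hq]

end General

variable {p : ℝ≥0∞} {X : Type*} [MeasurableSpace X] [MetricSpace X]

section

variable [SecondCountableTopology X] [BorelSpace X] [Fact (1 ≤ p)] [Fact (p ≠ ∞)]

protected theorem edist_self (μ : PSpace p X) : edist μ μ = 0 := by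
  refine le_antisymm ((edist_le_of_isCoupling (isCoupling_diag _)).trans_eq ?_) zero_le
  rw [lpSize_map (by fun_prop) (by fun_prop)]
  simp [lpSize, toReal_pos_of_fact p]

protected theorem edist_comm_le (μ ν : PSpace p X) : edist μ ν ≤ edist ν μ := by
  refine le_of_forall_gt fun c hc => ?_
  obtain ⟨γ, h, hγ⟩ := exists_isCoupling_lt hc
  refine (edist_le_of_isCoupling h.swap).trans_lt (hγ.trans_eq' ?_)
  rw [lpSize_map (by fun_prop) measurable_swap]
  simp [edist_comm]

protected theorem edist_triangle [StandardBorelSpace X] (μ ν ξ : PSpace p X) :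
    edist μ ξ ≤ edist μ ν + edist ν ξ := by
  rcases eq_or_ne (edist μ ν) ∞ with h₁ | h₁
  · simp [h₁]
  rcases eq_or_ne (edist ν ξ) ∞ with h₂ | h₂
  · simp [h₂]
  refine ENNReal.le_of_forall_pos_le_add fun ε hε _ => ?_
  have hε' : (0 : ℝ≥0∞) < ε / 2 := by simp [hε.ne']
  obtain ⟨γ, hγ, hγε⟩ := exists_isCoupling_lt (ENNReal.lt_add_right h₁ hε'.ne')
  obtain ⟨π, hπ, hπε⟩ := exists_isCoupling_lt (ENNReal.lt_add_right h₂ hε'.ne')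
  have := hγ.isProbabilityMeasure
  have := hπ.isProbabilityMeasure
  have : Nonempty X := μ.1.nonempty
  obtain ⟨θ, hθ₁, -, hθ₂⟩ := exists_glue γ measurable_snd π (hγ.map_snd.trans hπ.map_fst.symm).le
  specialize hθ₂ (hγ.map_snd.trans hπ.map_fst.symm)
  have hc : IsCoupling (θ.map fun ω => (ω.1.1, ω.2)) μ.toMeasure ξ.toMeasure := by
    constructor
    · rw [← hγ.map_fst, ← hθ₁, Measure.map_map (by fun_prop) (by fun_prop),
        Measure.map_map (by fun_prop) (by fun_prop)]
      rfl
    · rw [← hπ.map_snd, ← hθ₂, Measure.map_map (by fun_prop) (by fun_prop),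
        Measure.map_map (by fun_prop) (by fun_prop)]
      rfl
  calc edist μ ξ ≤ lpSize p (fun z => edist z.1 z.2) (θ.map fun ω => (ω.1.1, ω.2)) :=
        edist_le_of_isCoupling hc
    _ = lpSize p (fun ω => edist ω.1.1 ω.2) θ := lpSize_map (by fun_prop) (by fun_prop)
    _ ≤ lpSize p (fun ω => edist ω.1.1 ω.1.2 + edist ω.1.2 ω.2) θ :=
        lpSize_mono fun ω => edist_triangle _ _ _
    _ ≤ lpSize p (fun ω => edist ω.1.1 ω.1.2) θ + lpSize p (fun ω => edist ω.1.2 ω.2) θ :=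
        lpSize_add_le (by fun_prop) (by fun_prop)
    _ = lpSize p (fun z => edist z.1 z.2) γ + lpSize p (fun z => edist z.1 z.2) π := by
        conv_rhs => rw [← hθ₁, ← hθ₂]
        rw [lpSize_map (by fun_prop) (by fun_prop), lpSize_map (by fun_prop) (by fun_prop)]
    _ ≤ (edist μ ν + ε / 2) + (edist ν ξ + ε / 2) := add_le_add hγε.le hπε.le
    _ = edist μ ν + edist ν ξ + ε := by
        rw [add_add_add_comm, ENNReal.add_halves]

/-- A point mass has only the product coupling, so that its distance to `ν` is the `p`-th moment
of `ν`. -/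
theorem edist_dirac_rpow (x : X) (ν : PSpace p X) :
    edist (dirac p x) ν ^ p.toReal = ∫⁻ y, edist x y ^ p.toReal ∂ν.toMeasure := by
  refine le_antisymm (edist_dirac_le (toReal_pos_of_fact p) x ν) ?_
  refine le_of_forall_gt fun c hc => ?_
  rw [← ENNReal.lt_rpow_inv_iff (toReal_pos_of_fact p)] at hc
  obtain ⟨γ, hγ, hlt⟩ := exists_isCoupling_lt hc
  rw [ENNReal.lt_rpow_inv_iff (toReal_pos_of_fact p), lpSize_rpow] at hlt
  refine hlt.trans_eq' ?_
  rw [← hγ.map_snd, lintegral_map (by fun_prop) measurable_snd]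
  refine lintegral_congr_ae ?_
  have : ∀ᵐ z ∂γ, z.1 = x := by
    refine ae_of_ae_map measurable_fst.aemeasurable (p := fun z => z = x) ?_
    rw [hγ.map_fst]
    exact (ae_dirac_iff (measurableSet_singleton x)).2 rfl
  filter_upwards [this] with z hz
  rw [hz]

theorem lintegral_edist_rpow_lt_top (x : X) (μ : PSpace p X) :
    ∫⁻ y, edist x y ^ p.toReal ∂μ.toMeasure < ∞ :=
  (hasFiniteMoment_iff x).1 μ.2

protected theorem edist_lt_top [StandardBorelSpace X] (μ ν : PSpace p X) : edist μ ν < ∞ := by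
  obtain ⟨x⟩ := μ.1.nonempty
  have key : ∀ ν : PSpace p X, edist (dirac p x) ν < ∞ := fun ν => by
    have h := lintegral_edist_rpow_lt_top x ν
    rw [← edist_dirac_rpow] at h
    by_contra h'
    rw [not_lt, top_le_iff] at h'
    simp [h', toReal_pos_of_fact p] at h
  exact (PSpace.edist_triangle μ (dirac p x) ν).trans_lt
    (ENNReal.add_lt_top.2 ⟨(PSpace.edist_comm_le _ _).trans_lt (key μ), key ν⟩)

/-- The duality estimate for Lipschitz functions. -/
theorem enorm_integral_sub_integral_le {μ ν : PSpace p X} {f : X → ℝ} {L : ℝ≥0} {C : ℝ}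
    (hC : ∀ x, ‖f x‖ ≤ C) (hf : LipschitzWith L f) :
    ‖∫ x, f x ∂μ.toMeasure - ∫ x, f x ∂ν.toMeasure‖ₑ ≤ L * edist μ ν := by
  rcases eq_or_ne (edist μ ν) ∞ with h₁ | h₁
  · rcases eq_or_ne L 0 with rfl | hL
    · obtain ⟨x⟩ := μ.1.nonempty
      have : f = fun _ => f x := by
        ext y
        have := hf y x
        simpa using this
      rw [this]
      simp
    · simp [h₁, ENNReal.mul_top, hL]
  have hcont := hf.continuous
  have hint : ∀ (m : Measure X) [IsProbabilityMeasure m], Integrable f m := fun m _ =>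
    Integrable.of_bound hcont.aestronglyMeasurable C (ae_of_all _ hC)
  refine ENNReal.le_of_forall_pos_le_add fun ε hε _ => ?_
  have hε' : (ε : ℝ≥0∞) / (L + 1) ≠ 0 := by
    simp [hε.ne', ENNReal.div_eq_zero_iff]
  obtain ⟨γ, hγ, hγε⟩ := exists_isCoupling_lt (ENNReal.lt_add_right h₁ hε')
  have := hγ.isProbabilityMeasure
  have e₁ : ∫ x, f x ∂μ.toMeasure = ∫ z, f z.1 ∂γ := by
    rw [← hγ.map_fst, integral_map measurable_fst.aemeasurable hcont.aestronglyMeasurable]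
  have e₂ : ∫ x, f x ∂ν.toMeasure = ∫ z, f z.2 ∂γ := by
    rw [← hγ.map_snd, integral_map measurable_snd.aemeasurable hcont.aestronglyMeasurable]
  have i₁ : Integrable (fun z : X × X => f z.1) γ :=
    Integrable.of_bound (hcont.comp continuous_fst).aestronglyMeasurable C (ae_of_all _ fun z => hC _)
  have i₂ : Integrable (fun z : X × X => f z.2) γ :=
    Integrable.of_bound (hcont.comp continuous_snd).aestronglyMeasurable C (ae_of_all _ fun z => hC _)
  rw [e₁, e₂, ← integral_sub i₁ i₂]
  calc ‖∫ z, (f z.1 - f z.2) ∂γ‖ₑ ≤ ∫⁻ z, ‖f z.1 - f z.2‖ₑ ∂γ := enorm_integral_le_lintegral_enorm _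
    _ ≤ ∫⁻ z, L * edist z.1 z.2 ∂γ := by
        refine lintegral_mono fun z => ?_
        rw [← edist_eq_enorm_sub]
        exact hf _ _
    _ = L * ∫⁻ z, edist z.1 z.2 ∂γ := lintegral_const_mul _ (by fun_prop)
    _ ≤ L * (edist μ ν + ε / (L + 1)) := by
        gcongr
        exact (lintegral_le_lpSize (by fun_prop)).trans hγε.le
    _ ≤ L * edist μ ν + ε := by
        rw [mul_add]
        gcongr
        calc (L : ℝ≥0∞) * (ε / (L + 1)) ≤ (L + 1) * (ε / (L + 1)) := by gcongr; exact le_self_add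
          _ ≤ ε := ENNReal.mul_div_le

theorem tendsto_val_of_tendsto_edist {ι : Type*} {l : Filter ι} [l.IsCountablyGenerated]
    {u : ι → PSpace p X} {μ : PSpace p X} (h : Tendsto (fun i => edist (u i) μ) l (𝓝 0)) :
    Tendsto (fun i => (u i).1) l (𝓝 μ.1) := by
  rw [tendsto_iff_forall_lipschitz_integral_tendsto]
  rintro f ⟨C, hC⟩ ⟨L, hL⟩
  obtain ⟨x⟩ := μ.1.nonempty
  have hb : ∀ y, ‖f y‖ ≤ ‖f x‖ + C := fun y => by
    have := hC y x
    rw [Real.dist_eq] at this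
    rw [Real.norm_eq_abs, Real.norm_eq_abs]
    have h3 := abs_sub_abs_le_abs_sub (f y) (f x)
    linarith
  rw [tendsto_iff_edist_tendsto_0]
  have h0 : Tendsto (fun i => (L : ℝ≥0∞) * edist (u i) μ) l (𝓝 0) := by
    simpa using ENNReal.Tendsto.const_mul h (Or.inr ENNReal.coe_ne_top)
  refine tendsto_of_tendsto_of_tendsto_of_le_of_le tendsto_const_nhds h0 (fun _ => zero_le) fun i => ?_
  rw [edist_eq_enorm_sub]
  exact enorm_integral_sub_integral_le hb hL

variable [StandardBorelSpace X]

/-- The `p`-Wasserstein metric. Its topology is definitionally the given one. -/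
instance instEMetricSpace : EMetricSpace (PSpace p X) :=
  let E : PseudoEMetricSpace (PSpace p X) :=
    { edist_self := PSpace.edist_self
      edist_comm := fun μ ν => le_antisymm (PSpace.edist_comm_le μ ν) (PSpace.edist_comm_le ν μ)
      edist_triangle := PSpace.edist_triangle }
  have hT : (inferInstance : TopologicalSpace (PSpace p X)) =
      E.toUniformSpace.toTopologicalSpace := by
    ext U
    rw [EMetric.isOpen_iff]
    rfl
  { toEDist := inferInstance
    edist_self := E.edist_self
    edist_comm := E.edist_comm
    edist_triangle := E.edist_triangle
    toUniformSpace := E.toUniformSpace.replaceTopology hT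
    uniformity_edist := E.uniformity_edist
    eq_of_edist_eq_zero := fun {μ ν} h => by
      have h1 : Tendsto (fun _ : ℕ => edist μ ν) atTop (𝓝 0) := by
        rw [h]; exact tendsto_const_nhds
      have h2 := tendsto_val_of_tendsto_edist (u := fun _ : ℕ => μ) h1
      exact Subtype.ext (tendsto_nhds_unique tendsto_const_nhds h2) }

instance instMetricSpace : MetricSpace (PSpace p X) :=
  EMetricSpace.toMetricSpace fun μ ν => (PSpace.edist_lt_top μ ν).ne

end

end PSpace

/-! ### Wasserstein convergence is weak convergence with convergence of moments -/

section Subcoupling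

variable {X : Type*} [MeasurableSpace X]

theorem sum_restrict_le (μ : Measure X) {A : ℕ → Set X} (hA : ∀ n, MeasurableSet (A n))
    (hd : Pairwise fun n m => Disjoint (A n) (A m)) (s : Finset ℕ) :
    ∑ n ∈ s, μ.restrict (A n) ≤ μ := by
  refine Measure.le_iff.2 fun S hS => ?_
  rw [Measure.finsetSum_apply]
  simp only [Measure.restrict_apply hS]
  rw [← measure_biUnion_finset (fun i _ j _ hij => (hd hij).mono inter_subset_right inter_subset_right)
    fun n _ => hS.inter (hA n)]
  exact measure_mono (iUnion₂_subset fun _ _ => inter_subset_left)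

/-- Countably many disjoint small sets covering the space, whose boundaries are null sets. -/
theorem exists_partition_null_frontier [PseudoMetricSpace X] [SecondCountableTopology X]
    [BorelSpace X] (μ : Measure X) [SFinite μ] {ε : ℝ} (hε : 0 < ε) :
    ∃ A : ℕ → Set X, (∀ n, MeasurableSet (A n)) ∧ (∀ n, μ (frontier (A n)) = 0) ∧
      (∀ n, ∀ x ∈ A n, ∀ y ∈ A n, dist x y ≤ ε) ∧ ⋃ n, A n = univ ∧
      Pairwise fun n m => Disjoint (A n) (A m) := by
  rcases isEmpty_or_nonempty X with hX | hX
  · exact ⟨fun _ => ∅, by simp, by simp, by simp, Subsingleton.elim _ _, fun _ _ _ => by simp⟩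
  have hr : ∀ n, ∃ r ∈ Ioo (ε / 4) (ε / 2),
      μ (frontier (Metric.thickening r {TopologicalSpace.denseSeq X n})) = 0 :=
    fun n => exists_null_frontier_thickening μ _ (by linarith)
  choose r hr hr0 using hr
  let B : ℕ → Set X := fun n => Metric.ball (TopologicalSpace.denseSeq X n) (r n)
  refine ⟨disjointed B, MeasurableSet.disjointed fun n => measurableSet_ball, fun n => ?_,
    fun n x hx y hy => ?_, ?_, disjoint_disjointed B⟩
  · refine disjointedRec (p := fun t => μ (frontier t) = 0) (fun {t i} ht => ?_) ?_
    · refine measure_mono_null (t := frontier t ∪ frontier (B i)) ?_ (measure_union_null ht ?_)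
      · rw [sdiff_eq]
        refine (frontier_inter_subset _ _).trans (union_subset_union inter_subset_left ?_)
        rw [frontier_compl]
        exact inter_subset_right
      · simpa [Metric.thickening_singleton] using hr0 i
    · simpa [Metric.thickening_singleton] using hr0 n
  · have h1 := Metric.mem_ball.1 (disjointed_subset B n hx)
    have h2 := Metric.mem_ball'.1 (disjointed_subset B n hy)
    have := dist_triangle x (TopologicalSpace.denseSeq X n) y
    linarith [(hr n).2]
  · rw [iUnion_disjointed, eq_univ_iff_forall]
    intro x
    obtain ⟨n, hn⟩ := (TopologicalSpace.denseRange_denseSeq X).exists_dist_lt x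
      (show 0 < ε / 4 by linarith)
    exact mem_iUnion.2 ⟨n, Metric.mem_ball.2 (hn.trans (hr n).1)⟩

/-- Along a weakly convergent family, all but little of the mass can be coupled at a small
distance: on each cell of a fine partition, the two measures are coupled independently. -/
theorem eventually_exists_subcoupling [MetricSpace X] [SecondCountableTopology X] [BorelSpace X]
    {ι : Type*} {l : Filter ι} {u : ι → ProbabilityMeasure X} {μ : ProbabilityMeasure X}
    (h : Tendsto u l (𝓝 μ)) {ε : ℝ≥0} (hε : 0 < ε) {η : ℝ≥0} (hη : 0 < η) :
    ∀ᶠ i in l, ∃ γ : Measure (X × X), γ.map Prod.fst ≤ (u i : Measure X) ∧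
      γ.map Prod.snd ≤ (μ : Measure X) ∧ 1 ≤ γ univ + 2 * η ∧ ∀ᵐ z ∂γ, edist z.1 z.2 ≤ ε := by
  wlog hη1 : η < 1 generalizing η
  · filter_upwards [this (η := 1 / 2) (by norm_num) (by
      rw [← NNReal.coe_lt_coe]; norm_num)] with i ⟨γ, h1, h2, h3, h4⟩
    refine ⟨γ, h1, h2, h3.trans ?_, h4⟩
    gcongr
    exact_mod_cast ((by rw [← NNReal.coe_le_coe]; norm_num : (1 / 2 : ℝ≥0) ≤ 1)).trans (not_lt.1 hη1)
  obtain ⟨A, hAm, hA0, hAd, hAU, hAdisj⟩ :=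
    exists_partition_null_frontier (μ : Measure X) (ε := ε) (by exact_mod_cast hε)
  let s : ℝ≥0∞ := 1 - η
  have hη1' : (η : ℝ≥0∞) < 1 := by exact_mod_cast hη1
  have hs0 : s ≠ 0 := (tsub_pos_of_lt hη1').ne'
  have hs1 : s < 1 := ENNReal.sub_lt_self (by simp) (by simp) (by exact_mod_cast hη.ne')
  have hsη : s + η = 1 := tsub_add_cancel_of_le hη1'.le
  have hsum : ∑' n, (μ : Measure X) (A n) = 1 := by
    rw [← measure_iUnion hAdisj hAm, hAU, measure_univ]
  obtain ⟨J, hJ⟩ : ∃ J : Finset ℕ, 1 < ∑ n ∈ J, (μ : Measure X) (A n) + η := by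
    have h1 : (s : ℝ≥0∞) < ∑' n, (μ : Measure X) (A n) := by rw [hsum]; exact hs1
    rw [ENNReal.tsum_eq_iSup_sum, lt_iSup_iff] at h1
    obtain ⟨J, hJ⟩ := h1
    exact ⟨J, by rw [← hsη]; exact ENNReal.add_lt_add_right (by simp) hJ⟩
  have hev : ∀ᶠ i in l, ∀ n ∈ J, s * (μ : Measure X) (A n) ≤ (u i : Measure X) (A n) := by
    rw [Filter.eventually_all_finset]
    intro n _
    rcases eq_or_ne ((μ : Measure X) (A n)) 0 with h0 | h0
    · simp [h0]
    have hlt : s * (μ : Measure X) (A n) < (μ : Measure X) (A n) := by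
      conv_rhs => rw [← one_mul ((μ : Measure X) (A n))]
      exact ENNReal.mul_lt_mul_left h0 (measure_ne_top _ _) hs1
    filter_upwards [(ProbabilityMeasure.tendsto_measure_of_null_frontier_of_tendsto' h
      (hA0 n)).eventually_const_lt hlt] with i hi using hi.le
  filter_upwards [hev] with i hi
  let a : ℕ → ℝ≥0∞ := fun n => (u i : Measure X) (A n)
  let b : ℕ → ℝ≥0∞ := fun n => (μ : Measure X) (A n)
  have hmass : ∀ n ∈ J, s / a n * (a n * b n) = s * b n := by
    intro n hn
    rcases eq_or_ne (a n) 0 with h0 | h0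
    · have := hi n hn
      change s * b n ≤ a n at this
      rw [h0, le_zero_iff, mul_eq_zero, or_iff_right hs0] at this
      simp [this]
    · rw [← mul_assoc, ENNReal.div_mul_cancel h0 (measure_ne_top _ _)]
  refine ⟨∑ n ∈ J, (s / a n) • ((u i : Measure X).restrict (A n)).prod
    ((μ : Measure X).restrict (A n)), ?_, ?_, ?_, ?_⟩
  · rw [Measure.map_finset_sum measurable_fst.aemeasurable]
    refine (Finset.sum_le_sum fun n hn => ?_).trans (sum_restrict_le _ hAm hAdisj J)
    rw [Measure.map_smul, Measure.map_fst_prod, smul_smul]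
    refine Measure.le_iff.2 fun S _ => ?_
    rw [Measure.smul_apply, smul_eq_mul, Measure.restrict_apply_univ]
    refine mul_le_of_le_one_left' ?_
    rw [mul_comm, ← mul_div_assoc]
    refine ENNReal.div_le_of_le_mul ?_
    rw [one_mul, mul_comm]
    exact hi n hn
  · rw [Measure.map_finset_sum measurable_snd.aemeasurable]
    refine (Finset.sum_le_sum fun n hn => ?_).trans (sum_restrict_le _ hAm hAdisj J)
    rw [Measure.map_smul, Measure.map_snd_prod, smul_smul]
    refine Measure.le_iff.2 fun S _ => ?_
    rw [Measure.smul_apply, smul_eq_mul, Measure.restrict_apply_univ]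
    refine mul_le_of_le_one_left' (le_trans ?_ hs1.le)
    rw [mul_comm]
    exact ENNReal.mul_div_le
  · have : (∑ n ∈ J, (s / a n) • ((u i : Measure X).restrict (A n)).prod
        ((μ : Measure X).restrict (A n))) univ = s * ∑ n ∈ J, b n := by
      rw [Measure.finsetSum_apply, Finset.mul_sum]
      refine Finset.sum_congr rfl fun n hn => ?_
      rw [Measure.smul_apply, smul_eq_mul, ← univ_prod_univ, Measure.prod_prod,
        Measure.restrict_apply_univ, Measure.restrict_apply_univ]
      exact hmass n hn
    rw [this]
    calc (1 : ℝ≥0∞) = s * 1 + η := by rw [mul_one, hsη]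
      _ ≤ s * (∑ n ∈ J, b n + η) + η := by gcongr
      _ ≤ s * ∑ n ∈ J, b n + 2 * η := by
          rw [mul_add, two_mul, add_assoc]
          gcongr
          exact mul_le_of_le_one_left' hs1.le
  · rw [ae_iff, Measure.finsetSum_apply]
    refine Finset.sum_eq_zero fun n _ => ae_iff.1 ?_
    refine Measure.ae_smul_measure ?_ _
    rw [Measure.prod_restrict, ae_restrict_iff' ((hAm n).prod (hAm n))]
    refine ae_of_all _ fun z hz => ?_
    rw [edist_dist, ENNReal.ofReal_le_iff_le_toReal (by simp)]
    exact hAd n _ hz.1 _ hz.2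

end Subcoupling

namespace PSpace

variable {p : ℝ≥0∞} [Fact (1 ≤ p)] [Fact (p ≠ ∞)]
  {X : Type*} [MeasurableSpace X] [MetricSpace X] [SecondCountableTopology X] [BorelSpace X]

/-- A partial coupling can be completed by coupling the remainders independently. -/
theorem edist_rpow_le_of_subcoupling (μ ν : PSpace p X) (x : X) (γ : Measure (X × X))
    (h₁ : γ.map Prod.fst ≤ μ.toMeasure) (h₂ : γ.map Prod.snd ≤ ν.toMeasure) :
    edist μ ν ^ p.toReal ≤ ∫⁻ z, edist z.1 z.2 ^ p.toReal ∂γ +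
      2 ^ (p.toReal - 1) * (∫⁻ y, edist x y ^ p.toReal ∂(μ.toMeasure - γ.map Prod.fst) +
        ∫⁻ y, edist x y ^ p.toReal ∂(ν.toMeasure - γ.map Prod.snd)) := by
  have hfin₁ : IsFiniteMeasure (γ.map Prod.fst) := isFiniteMeasure_of_le _ h₁
  have hfin₂ : IsFiniteMeasure (γ.map Prod.snd) := isFiniteMeasure_of_le _ h₂
  set m₁ := μ.toMeasure - γ.map Prod.fst with hm₁
  set m₂ := ν.toMeasure - γ.map Prod.snd with hm₂
  have e₁ : m₁ + γ.map Prod.fst = μ.toMeasure := Measure.sub_add_cancel_of_le h₁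
  have e₂ : m₂ + γ.map Prod.snd = ν.toMeasure := Measure.sub_add_cancel_of_le h₂
  have hRf₁ : IsFiniteMeasure m₁ := isFiniteMeasure_of_le μ.toMeasure Measure.sub_le
  have hRf₂ : IsFiniteMeasure m₂ := isFiniteMeasure_of_le ν.toMeasure Measure.sub_le
  have hu : m₁ univ = m₂ univ := by
    have h1 : m₁ univ = 1 - γ univ := by
      rw [hm₁, Measure.sub_apply MeasurableSet.univ h₁, measure_univ,
        Measure.map_apply measurable_fst MeasurableSet.univ, preimage_univ]
    have h2 : m₂ univ = 1 - γ univ := by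
      rw [hm₂, Measure.sub_apply MeasurableSet.univ h₂, measure_univ,
        Measure.map_apply measurable_snd MeasurableSet.univ, preimage_univ]
    rw [h1, h2]
  have hcancel : ∀ (R : Measure X) [IsFiniteMeasure R], (R univ)⁻¹ • R univ • R = R := by
    intro R _
    rcases eq_or_ne (R univ) 0 with h0 | h0
    · simp [Measure.measure_univ_eq_zero.1 h0]
    · rw [smul_smul, ENNReal.inv_mul_cancel h0 (measure_ne_top _ _), one_smul]
  have hc : IsCoupling (γ + (m₁ univ)⁻¹ • m₁.prod m₂) μ.toMeasure ν.toMeasure := by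
    constructor
    · rw [Measure.map_add _ _ measurable_fst, Measure.map_smul, Measure.map_fst_prod, ← hu, hcancel, add_comm, e₁]
    · rw [Measure.map_add _ _ measurable_snd, Measure.map_smul, Measure.map_snd_prod, hu, hcancel, add_comm, e₂]
  refine (ENNReal.rpow_le_rpow (edist_le_of_isCoupling hc) (toReal_pos_of_fact p).le).trans ?_
  rw [lpSize_rpow, lintegral_add_measure, lintegral_smul_measure]
  gcongr
  have hC : (2 : ℝ≥0∞) ^ (p.toReal - 1) ≠ ∞ :=
    (ENNReal.rpow_lt_top_of_nonneg (by linarith [one_le_toReal_of_fact p]) (by simp)).ne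
  have hmeas : Measurable fun y => edist x y ^ p.toReal := by fun_prop
  calc (m₁ univ)⁻¹ • ∫⁻ z, edist z.1 z.2 ^ p.toReal ∂(m₁.prod m₂)
      ≤ (m₁ univ)⁻¹ • ∫⁻ z, 2 ^ (p.toReal - 1) *
          (edist x z.1 ^ p.toReal + edist x z.2 ^ p.toReal) ∂(m₁.prod m₂) := by
        rw [smul_eq_mul, smul_eq_mul]
        gcongr with z
        exact edist_rpow_le_two_mul _ _ _
    _ = (m₁ univ)⁻¹ * m₁ univ * (2 ^ (p.toReal - 1) * (∫⁻ y, edist x y ^ p.toReal ∂m₁ +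
          ∫⁻ y, edist x y ^ p.toReal ∂m₂)) := by
        rw [lintegral_const_mul' _ _ hC, lintegral_add_left (by fun_prop),
          ← lintegral_map (f := fun y => edist x y ^ p.toReal) (g := Prod.fst) hmeas measurable_fst,
          ← lintegral_map (f := fun y => edist x y ^ p.toReal) (g := Prod.snd) hmeas measurable_snd,
          Measure.map_fst_prod, Measure.map_snd_prod, lintegral_smul_measure,
          lintegral_smul_measure, ← hu, smul_eq_mul, smul_eq_mul, smul_eq_mul]
        ring
    _ ≤ _ := mul_le_of_le_one_left' (ENNReal.inv_mul_le_one _)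

/-- The truncation error of an integrable function vanishes in the limit. -/
theorem exists_lintegral_tsub_rpow_lt {Ω : Type*} [MeasurableSpace Ω] {μ : Measure Ω}
    {f : Ω → ℝ≥0∞} (hf : Measurable f) {r : ℝ} (hr : 0 < r) (hfi : ∫⁻ ω, f ω ^ r ∂μ ≠ ∞)
    {ε : ℝ≥0∞} (hε : 0 < ε) :
    ∃ M : ℝ≥0, ∫⁻ ω, (f ω - M) ^ r ∂μ < ε := by
  have h : Tendsto (fun n : ℕ => ∫⁻ ω, (f ω - (n : ℝ≥0)) ^ r ∂μ) atTop (𝓝 (∫⁻ _, 0 ∂μ)) := by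
    refine tendsto_lintegral_of_dominated_convergence (fun ω => f ω ^ r) (fun n => by fun_prop)
      (fun n => ae_of_all _ fun ω => ENNReal.rpow_le_rpow tsub_le_self hr.le) hfi ?_
    filter_upwards [ae_lt_top (hf.pow_const r) hfi] with ω hω
    refine tendsto_const_nhds.congr' ?_
    have hω' : f ω ≠ ∞ := fun h => by simp [h, hr] at hω
    obtain ⟨n, hn⟩ := ENNReal.exists_nat_gt hω'
    filter_upwards [eventually_ge_atTop n] with m hm
    rw [tsub_eq_zero_of_le (hn.le.trans (by exact_mod_cast hm)), ENNReal.zero_rpow_of_pos hr]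
  rw [lintegral_zero] at h
  obtain ⟨n, hn⟩ := (h.eventually_lt_const hε).exists
  exact ⟨n, hn⟩

theorem tendsto_lintegral_min_of_tendsto {ι : Type*} {l : Filter ι} {u : ι → ProbabilityMeasure X}
    {μ : ProbabilityMeasure X} (h : Tendsto u l (𝓝 μ)) {f : X → ℝ≥0∞} (hf : Continuous f)
    (M : ℝ≥0) :
    Tendsto (fun i => ∫⁻ y, min (f y) M ∂(u i : Measure X)) l
      (𝓝 (∫⁻ y, min (f y) M ∂(μ : Measure X))) := by
  have hlt : ∀ y, min (f y) M ≠ ∞ := fun y => ne_top_of_le_ne_top ENNReal.coe_ne_top (min_le_right _ _)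
  have hcont : Continuous fun y => (min (f y) M).toNNReal := by
    refine ENNReal.continuousOn_toNNReal.comp_continuous (hf.min continuous_const) hlt
  have hle : ∀ y, (min (f y) M).toNNReal ≤ M := fun y => by
    rw [← ENNReal.coe_le_coe, ENNReal.coe_toNNReal (hlt y)]
    exact min_le_right _ _
  let g : BoundedContinuousFunction X ℝ≥0 :=
    BoundedContinuousFunction.mkOfBound ⟨_, hcont⟩ M fun x y => by
      rw [NNReal.dist_eq]
      have h1 : ((min (f x) M).toNNReal : ℝ) ≤ M := by exact_mod_cast hle x
      have h2 : ((min (f y) M).toNNReal : ℝ) ≤ M := by exact_mod_cast hle y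
      simp only [ContinuousMap.coe_mk]
      rw [abs_le]
      constructor <;> linarith [NNReal.coe_nonneg (min (f x) M).toNNReal,
        NNReal.coe_nonneg (min (f y) M).toNNReal]
  have hg : ∀ y, (g y : ℝ≥0∞) = min (f y) M := fun y => ENNReal.coe_toNNReal (hlt y)
  simpa only [hg] using ProbabilityMeasure.tendsto_iff_forall_lintegral_tendsto.1 h g

theorem lintegral_tsub_add_lintegral_min {Ω : Type*} [MeasurableSpace Ω] (μ : Measure Ω)
    {f : Ω → ℝ≥0∞} (hf : Measurable f) (M : ℝ≥0) :
    ∫⁻ ω, (f ω - M) ∂μ + ∫⁻ ω, min (f ω) M ∂μ = ∫⁻ ω, f ω ∂μ := by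
  rw [← lintegral_add_left (by fun_prop)]
  simp only [tsub_add_min]

/-- Weak convergence provides partial couplings of almost full mass which displace little, and the
convergence of the moments makes the transport cost of the remaining mass small. -/
theorem tendsto_edist_of_tendsto_val {ι : Type*} {l : Filter ι} {u : ι → PSpace p X}
    {μ : PSpace p X} (h : Tendsto (fun i => (u i).1) l (𝓝 μ.1)) (x : X)
    (hm : Tendsto (fun i => ∫⁻ y, edist x y ^ p.toReal ∂(u i).toMeasure) l
      (𝓝 (∫⁻ y, edist x y ^ p.toReal ∂μ.toMeasure))) :
    Tendsto (fun i => edist (u i) μ) l (𝓝 0) := by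
  have hq := toReal_pos_of_fact p
  have hC : (2 : ℝ≥0∞) ^ (p.toReal - 1) ≠ ∞ :=
    (ENNReal.rpow_lt_top_of_nonneg (by linarith [one_le_toReal_of_fact p]) (by simp)).ne
  let a : X → ℝ≥0∞ := fun y => edist x y ^ p.toReal
  have ha : Continuous a := by fun_prop
  have key : ∀ ε : ℝ≥0, 0 < ε → ∀ᶠ i in l, edist (u i) μ ^ p.toReal ≤
      (ε : ℝ≥0∞) ^ p.toReal + 2 ^ (p.toReal - 1) * (4 * ε) := by
    intro ε hε
    have hε' : (0 : ℝ≥0∞) < ε := by exact_mod_cast hε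
    have hμ : ∫⁻ y, a y ∂μ.toMeasure ≠ ∞ := (lintegral_edist_rpow_lt_top x μ).ne
    obtain ⟨M, hM⟩ := exists_lintegral_tsub_rpow_lt ha.measurable one_pos (by simpa using hμ) hε'
    simp only [ENNReal.rpow_one] at hM
    obtain ⟨η, hη, hηM⟩ : ∃ η : ℝ≥0, 0 < η ∧ M * (2 * η) ≤ ε := by
      refine ⟨ε / (2 * (M + 1)), by positivity, ?_⟩
      calc M * (2 * (ε / (2 * (M + 1)))) = M / (M + 1) * ε := by field_simp
        _ ≤ 1 * ε := by
            gcongr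
            exact div_le_one_of_le₀ (by simp) (by positivity)
        _ = ε := one_mul _
    have htail : Tendsto (fun i => ∫⁻ y, (a y - M) ∂(u i).toMeasure) l
        (𝓝 (∫⁻ y, (a y - M) ∂μ.toMeasure)) := by
      have e : ∀ ν : PSpace p X, ∫⁻ y, (a y - M) ∂ν.toMeasure =
          ∫⁻ y, a y ∂ν.toMeasure - ∫⁻ y, min (a y) M ∂ν.toMeasure := fun ν => by
        rw [← lintegral_tsub_add_lintegral_min ν.toMeasure ha.measurable M]
        refine (ENNReal.add_sub_cancel_right ?_).symm
        refine ((lintegral_mono fun y => min_le_right _ _).trans_lt ?_).ne (b := ∞)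
        simp
      simp only [e]
      refine ENNReal.Tendsto.sub hm (tendsto_lintegral_min_of_tendsto h ha M) (Or.inl hμ)
    filter_upwards [eventually_exists_subcoupling h hε hη, htail.eventually_lt_const hM] with
      i ⟨γ, h₁, h₂, hmass, hclose⟩ hi
    have hfin₁ : IsFiniteMeasure (γ.map Prod.fst) := isFiniteMeasure_of_le (u i).toMeasure h₁
    have hfin₂ : IsFiniteMeasure (γ.map Prod.snd) := isFiniteMeasure_of_le μ.toMeasure h₂
    have hγ1 : γ univ ≤ 1 := by
      have := h₂ univ
      rwa [Measure.map_apply measurable_snd MeasurableSet.univ, preimage_univ,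
        measure_univ (μ := (μ.1 : Measure X))] at this
    have hrest : ∀ (ν : Measure X) [IsProbabilityMeasure ν] (π : Measure X) [IsFiniteMeasure π],
        π ≤ ν → π univ = γ univ → ∫⁻ y, (a y - M) ∂ν < ε → ∫⁻ y, a y ∂(ν - π) ≤ 2 * ε := by
      intro ν _ π _ hle hu hν
      have hR : (ν - π) univ ≤ 2 * η := by
        rw [Measure.sub_apply MeasurableSet.univ hle, measure_univ, hu]
        exact tsub_le_iff_left.2 hmass
      calc ∫⁻ y, a y ∂(ν - π) ≤ ∫⁻ y, ((a y - M) + M) ∂(ν - π) :=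
            lintegral_mono fun y => le_tsub_add
        _ = ∫⁻ y, (a y - M) ∂(ν - π) + M * (ν - π) univ := by
            rw [lintegral_add_right _ measurable_const, lintegral_const]
        _ ≤ ∫⁻ y, (a y - M) ∂ν + M * (2 * η) := by
            gcongr
            exact Measure.sub_le
        _ ≤ ε + ε := by
            gcongr
            exact_mod_cast hηM
        _ = 2 * ε := (two_mul _).symm
    calc edist (u i) μ ^ p.toReal ≤ _ := edist_rpow_le_of_subcoupling (u i) μ x γ h₁ h₂
      _ ≤ (ε : ℝ≥0∞) ^ p.toReal + 2 ^ (p.toReal - 1) * (2 * ε + 2 * ε) := by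
          gcongr
          · calc ∫⁻ z, edist z.1 z.2 ^ p.toReal ∂γ ≤ ∫⁻ z, (ε : ℝ≥0∞) ^ p.toReal ∂γ := by
                  refine lintegral_mono_ae ?_
                  filter_upwards [hclose] with z hz
                  gcongr
              _ ≤ (ε : ℝ≥0∞) ^ p.toReal := by
                  rw [lintegral_const]
                  exact mul_le_of_le_one_right' hγ1
          · refine hrest (u i).toMeasure _ h₁ ?_ hi
            rw [Measure.map_apply measurable_fst MeasurableSet.univ, preimage_univ]
          · refine hrest μ.toMeasure _ h₂ ?_ hM
            rw [Measure.map_apply measurable_snd MeasurableSet.univ, preimage_univ]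
      _ = _ := by rw [← add_mul]; norm_num
  have hlim : Tendsto (fun ε : ℝ≥0 => (ε : ℝ≥0∞) ^ p.toReal + 2 ^ (p.toReal - 1) * (4 * ε))
      (𝓝[>] 0) (𝓝 0) := by
    have hc : Continuous fun ε : ℝ≥0 => (ε : ℝ≥0∞) ^ p.toReal + 2 ^ (p.toReal - 1) * (4 * ε) := by
      refine (ENNReal.continuous_rpow_const.comp ENNReal.continuous_coe).add ?_
      exact (ENNReal.continuous_const_mul hC).comp
        ((ENNReal.continuous_const_mul (by simp)).comp ENNReal.continuous_coe)
    have := hc.tendsto 0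
    simp only [ENNReal.coe_zero, ENNReal.zero_rpow_of_pos hq, mul_zero, add_zero] at this
    exact this.mono_left nhdsWithin_le_nhds
  rw [ENNReal.tendsto_nhds_zero]
  intro c hc
  have hc' : 0 < c ^ p.toReal := ENNReal.rpow_pos_of_nonneg hc hq.le
  obtain ⟨ε, hε, hε0⟩ := ((hlim.eventually_lt_const hc').and self_mem_nhdsWithin).exists
  filter_upwards [key ε hε0] with i hi
  exact (ENNReal.rpow_le_rpow_iff hq).1 (hi.trans hε.le)

variable [StandardBorelSpace X]

/-- Convergence in the Wasserstein metric is weak convergence together with convergence of the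
`p`-th moments. -/
theorem tendsto_nhds_iff {ι : Type*} {l : Filter ι} [l.IsCountablyGenerated] {u : ι → PSpace p X}
    {μ : PSpace p X} (x : X) :
    Tendsto u l (𝓝 μ) ↔ Tendsto (fun i => (u i).1) l (𝓝 μ.1) ∧
      Tendsto (fun i => ∫⁻ y, edist x y ^ p.toReal ∂(u i).toMeasure) l
        (𝓝 (∫⁻ y, edist x y ^ p.toReal ∂μ.toMeasure)) := by
  rw [tendsto_iff_edist_tendsto_0]
  refine ⟨fun h => ⟨tendsto_val_of_tendsto_edist h, ?_⟩,
    fun h => tendsto_edist_of_tendsto_val h.1 x h.2⟩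
  simp only [← edist_dirac_rpow]
  refine ((ENNReal.continuous_rpow_const (y := p.toReal)).tendsto _).comp ?_
  exact tendsto_const_nhds.edist (tendsto_iff_edist_tendsto_0.2 h)

theorem continuous_val : Continuous fun μ : PSpace p X => μ.1 := by
  rw [continuous_iff_continuousAt]
  intro μ
  obtain ⟨x⟩ := μ.1.nonempty
  exact ((tendsto_nhds_iff x).1 tendsto_id).1

end PSpace

/-! ### The Borel structure of spaces of probability measures -/

theorem MeasurableEmbedding.standardBorelSpace {α β : Type*} [MeasurableSpace α]
    [MeasurableSpace β] [StandardBorelSpace β] {f : α → β} (hf : MeasurableEmbedding f) :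
    StandardBorelSpace α := by
  have hr := hf.measurableSet_range.standardBorel
  let e : α ≃ᵐ range f := hf.equivRange
  obtain ⟨t₀, hB, hP⟩ := hr.polish
  let t : TopologicalSpace α := t₀.induced e
  let h : α ≃ₜ range f := e.toEquiv.toHomeomorphOfIsInducing ⟨rfl⟩
  refine ⟨t, ⟨?_⟩, h.isClosedEmbedding.polishSpace⟩
  rw [borel_comap, ← hB.measurable_eq]
  exact (MeasurableEmbedding.iff_comap_eq.1 e.measurableEmbedding).2.1.symm

instance WithLp.standardBorelSpace (p : ℝ≥0∞) (X : Type*) [MeasurableSpace X]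
    [StandardBorelSpace X] : StandardBorelSpace (WithLp p X) :=
  (MeasurableEquiv.toLp p X).symm.measurableEmbedding.standardBorelSpace

theorem isInducing_of_continuous_of_tendsto {α β : Type*} [TopologicalSpace α]
    [TopologicalSpace β] {f : α → β} (hf : Continuous f)
    (h : ∀ a, Tendsto id (comap f (𝓝 (f a))) (𝓝 a)) : IsInducing f := by
  rw [isInducing_iff_nhds]
  exact fun a => le_antisymm (tendsto_iff_comap.1 (hf.tendsto a)) (h a)

namespace MeasureTheory.ProbabilityMeasure

/-- The weak topology is generated by the integrals of bounded continuous functions, so that it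
suffices to have countably many open sets generating it. -/
theorem borelSpace_of_secondCountableTopology {X : Type*} [TopologicalSpace X]
    [MeasurableSpace X] [BorelSpace X] [HasOuterApproxClosed X]
    [SecondCountableTopology (ProbabilityMeasure X)] : BorelSpace (ProbabilityMeasure X) := by
  let S : Set (Set (ProbabilityMeasure X)) := {s | ∃ (f : BoundedContinuousFunction X ℝ≥0)
    (U : Set ℝ≥0∞), IsOpen U ∧ s = (fun μ : ProbabilityMeasure X => ∫⁻ x, f x ∂(μ : Measure X)) ⁻¹' U}
  have hS : (inferInstance : TopologicalSpace (ProbabilityMeasure X)) =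
      TopologicalSpace.generateFrom S := by
    refine le_antisymm (le_generateFrom ?_) ?_
    · rintro _ ⟨f, U, hU, rfl⟩
      exact hU.preimage (continuous_lintegral_boundedContinuousFunction f)
    · refine continuous_id_iff_le.1 ?_
      let t := TopologicalSpace.generateFrom S
      refine (@continuous_iff_forall_continuous_lintegral X _ _ _ (ProbabilityMeasure X) t id).2
        fun f => ?_
      exact continuous_def.2 fun U hU => TopologicalSpace.isOpen_generateFrom_of_mem ⟨f, U, hU, rfl⟩
  refine ⟨le_antisymm ?_ ?_⟩
  · refine MeasurableSpace.comap_le_iff_le_map.2 ?_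
    refine @Measurable.measure_of_isPiSystem_of_isProbabilityMeasure _ _ (borel _) _
      (fun μ : ProbabilityMeasure X => (μ : Measure X)) _ _ (BorelSpace.measurable_eq.trans rfl)
      isPiSystem_isOpen fun G hG => ?_
    let m := borel (ProbabilityMeasure X)
    have : BorelSpace (ProbabilityMeasure X) := ⟨rfl⟩
    refine LowerSemicontinuous.measurable fun μ => ?_
    exact fun c hc => eventually_lt_of_lt_liminf (hc.trans_le
      (le_liminf_measure_open_of_tendsto tendsto_id hG))
  · rw [borel_eq_generateFrom_of_subbasis hS]
    refine MeasurableSpace.generateFrom_le ?_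
    rintro _ ⟨f, U, hU, rfl⟩
    refine Measurable.comp (g := fun m : Measure X => ∫⁻ x, f x ∂m) ?_ measurable_subtype_coe
      hU.measurableSet
    exact Measure.measurable_lintegral (by fun_prop)

theorem isInducing_map {X Y : Type*} [TopologicalSpace X] [MeasurableSpace X] [BorelSpace X]
    [TopologicalSpace Y] [MeasurableSpace Y] [BorelSpace Y] [HasOuterApproxClosed Y]
    [FirstCountableTopology (ProbabilityMeasure Y)] {f : X → Y} (hf : IsInducing f) :
    IsInducing fun μ : ProbabilityMeasure X => μ.map hf.continuous.measurable.aemeasurable := by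
  refine isInducing_of_continuous_of_tendsto (continuous_map hf.continuous) fun μ => ?_
  refine tendsto_of_forall_isOpen_le_liminf' fun G hG => ?_
  obtain ⟨V, hV, rfl⟩ := hf.isOpen_iff.1 hG
  have h := le_liminf_measure_open_of_tendsto (L := comap (fun μ : ProbabilityMeasure X =>
    μ.map hf.continuous.measurable.aemeasurable) (𝓝 (μ.map hf.continuous.measurable.aemeasurable)))
    tendsto_comap hV
  simp only [toMeasure_map] at h
  rw [Measure.map_apply hf.continuous.measurable hV.measurableSet] at h
  refine h.trans_eq (liminf_congr (Eventually.of_forall fun ν => ?_))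
  exact Measure.map_apply hf.continuous.measurable hV.measurableSet

/-- Over a compact metrizable space, the probability measures form a compact metrizable space. -/
theorem secondCountableTopology_of_compactSpace (K : Type*) [TopologicalSpace K]
    [CompactSpace K] [TopologicalSpace.MetrizableSpace K] [MeasurableSpace K] [BorelSpace K] :
    SecondCountableTopology (ProbabilityMeasure K) := by
  let := TopologicalSpace.metrizableSpaceMetric K
  let := TopologicalSpace.metrizableSpaceMetric (ProbabilityMeasure K)
  infer_instance

instance secondCountableTopology {X : Type*} [MetricSpace X] [SecondCountableTopology X]
    [MeasurableSpace X] [BorelSpace X] : SecondCountableTopology (ProbabilityMeasure X) := by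
  obtain ⟨F, hF⟩ := Metric.PiNatEmbed.exists_embedding_to_hilbert_cube (X := X)
  have := secondCountableTopology_of_compactSpace (ℕ → unitInterval)
  exact (isInducing_map hF.isInducing).secondCountableTopology

instance borelSpace {X : Type*} [MetricSpace X] [SecondCountableTopology X]
    [MeasurableSpace X] [BorelSpace X] : BorelSpace (ProbabilityMeasure X) :=
  borelSpace_of_secondCountableTopology

end MeasureTheory.ProbabilityMeasure

namespace PSpace

variable {p : ℝ≥0∞} [Fact (1 ≤ p)] [Fact (p ≠ ∞)]
  {X : Type*} [MeasurableSpace X] [MetricSpace X] [SecondCountableTopology X] [BorelSpace X]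

theorem measurable_toMeasure : Measurable (toMeasure : PSpace p X → Measure X) :=
  comap_measurable _

theorem measurable_lintegral {f : X → ℝ≥0∞} (hf : Measurable f) :
    Measurable fun μ : PSpace p X => ∫⁻ x, f x ∂μ.toMeasure :=
  (Measure.measurable_lintegral hf).comp measurable_toMeasure

variable [StandardBorelSpace X]

theorem isInducing_val_moment (x : X) :
    IsInducing fun μ : PSpace p X => (μ.1, ∫⁻ y, edist x y ^ p.toReal ∂μ.toMeasure) := by
  refine isInducing_of_continuous_of_tendsto ?_ fun μ => ?_
  · rw [continuous_iff_continuousAt]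
    intro μ
    exact ((tendsto_nhds_iff x).1 tendsto_id).1.prodMk_nhds ((tendsto_nhds_iff x).1 tendsto_id).2
  · rw [tendsto_nhds_iff x]
    rw [nhds_prod_eq]
    exact ⟨tendsto_fst.comp tendsto_comap, tendsto_snd.comp tendsto_comap⟩

instance secondCountableTopology : SecondCountableTopology (PSpace p X) := by
  rcases isEmpty_or_nonempty (PSpace p X) with h | ⟨⟨μ⟩⟩
  · infer_instance
  · obtain ⟨x⟩ := μ.1.nonempty
    exact (isInducing_val_moment x).secondCountableTopology

/-- The evaluations generate the Borel `σ`-algebra of the Wasserstein topology, since the latter is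
the initial topology for the weak topology and the `p`-th moment. -/
instance borelSpace : BorelSpace (PSpace p X) := by
  rcases isEmpty_or_nonempty (PSpace p X) with h | ⟨⟨μ⟩⟩
  · exact ⟨MeasurableSpace.ext fun s => by simp [Set.eq_empty_of_isEmpty s]⟩
  obtain ⟨x⟩ := μ.1.nonempty
  refine ⟨?_⟩
  rw [(isInducing_val_moment x).eq_induced, borel_comap, ← BorelSpace.measurable_eq]
  refine le_antisymm ?_ ?_
  · refine MeasurableSpace.comap_le_iff_le_map.2 ?_
    have : @Measurable _ _ (MeasurableSpace.comap (fun μ : PSpace p X =>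
        (μ.1, ∫⁻ y, edist x y ^ p.toReal ∂μ.toMeasure)) inferInstance) _ toMeasure :=
      measurable_subtype_coe.comp (measurable_fst.comp (comap_measurable _))
    exact this
  · refine MeasurableSpace.comap_le_iff_le_map.2 ?_
    have : Measurable (fun μ : PSpace p X => (μ.1, ∫⁻ y, edist x y ^ p.toReal ∂μ.toMeasure)) := by
      refine Measurable.prodMk ?_ (measurable_lintegral (by fun_prop))
      exact measurable_toMeasure.subtype_mk (h := fun μ : PSpace p X => μ.1.2)
    exact this

/-- The measures on `X` are the measures on the Hilbert cube concentrated on a copy of `X`, and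
the finiteness of a moment is a measurable condition. -/
instance standardBorelSpace : StandardBorelSpace (PSpace p X) := by
  rcases isEmpty_or_nonempty (PSpace p X) with h | ⟨⟨μ⟩⟩
  · infer_instance
  obtain ⟨x⟩ := μ.1.nonempty
  obtain ⟨F, hF⟩ := Metric.PiNatEmbed.exists_embedding_to_hilbert_cube (X := X)
  have hFm : MeasurableEmbedding F := hF.continuous.measurable.measurableEmbedding hF.injective
  have := ProbabilityMeasure.secondCountableTopology_of_compactSpace (ℕ → unitInterval)
  have : BorelSpace (ProbabilityMeasure (ℕ → unitInterval)) :=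
    ProbabilityMeasure.borelSpace_of_secondCountableTopology
  have : PolishSpace (ProbabilityMeasure (ℕ → unitInterval)) := by
    let := TopologicalSpace.metrizableSpaceMetric (ProbabilityMeasure (ℕ → unitInterval))
    infer_instance
  let e : PSpace p X → ProbabilityMeasure (ℕ → unitInterval) := fun μ =>
    μ.1.map hFm.measurable.aemeasurable
  have he : ∀ μ, (e μ : Measure (ℕ → unitInterval)) = μ.toMeasure.map F := fun μ => rfl
  refine MeasurableEmbedding.standardBorelSpace (f := e)
    (MeasurableEmbedding.iff_comap_eq.2 ⟨fun μ ν h => ?_, le_antisymm ?_ ?_, ?_⟩)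
  · have h' : (e μ : Measure (ℕ → unitInterval)) = e ν := congrArg _ h
    rw [he, he] at h'
    ext S hS
    have := congrArg (fun m => m (F '' S)) h'
    simpa only [hFm.map_apply, hF.injective.preimage_image] using this
  · refine MeasurableSpace.comap_le_iff_le_map.2 ?_
    have : Measurable e := by
      have h1 : Measurable fun μ : PSpace p X => μ.toMeasure.map F :=
        (Measure.measurable_map F hFm.measurable).comp measurable_toMeasure
      exact h1.subtype_mk (h := fun μ : PSpace p X => (e μ).2)
    exact this
  · refine MeasurableSpace.comap_le_iff_le_map.2 ?_
    have : @Measurable _ _ (MeasurableSpace.comap e inferInstance) _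
        (toMeasure : PSpace p X → Measure X) := by
      have h1 : (toMeasure : PSpace p X → Measure X) = fun μ =>
          (fun m : Measure (ℕ → unitInterval) => m.comap F) (e μ : Measure _) := by
        funext μ
        rw [he]
        exact (hFm.comap_map _).symm
      rw [h1]
      refine Measurable.comp (g := fun m : Measure (ℕ → unitInterval) => m.comap F) ?_
        (measurable_subtype_coe.comp (comap_measurable e))
      refine Measure.measurable_of_measurable_coe _ fun S hS => ?_
      simp only [hFm.comap_apply]
      exact Measure.measurable_coe (hFm.measurableSet_image' hS)
    exact this
  · have hr : range e = {ν : ProbabilityMeasure (ℕ → unitInterval) |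
        (ν : Measure (ℕ → unitInterval)) (range F)ᶜ = 0 ∧
        ∫⁻ y, edist x y ^ p.toReal ∂((ν : Measure (ℕ → unitInterval)).comap F) < ∞} := by
      ext ν
      constructor
      · rintro ⟨μ, rfl⟩
        constructor
        · rw [he, hFm.map_apply]
          simp
        · rw [he, hFm.comap_map]
          exact lintegral_edist_rpow_lt_top x μ
      · rintro ⟨h0, hm⟩
        have hmap : ((ν : Measure (ℕ → unitInterval)).comap F).map F = ν := by
          rw [hFm.map_comap, Measure.restrict_eq_self_of_ae_mem]
          exact mem_ae_iff.2 h0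
        have hp : IsProbabilityMeasure ((ν : Measure (ℕ → unitInterval)).comap F) := by
          refine ⟨?_⟩
          have := congrArg (fun m => m univ) hmap
          simpa [hFm.map_apply] using this
        exact ⟨⟨⟨_, hp⟩, ⟨x, hm⟩⟩, Subtype.ext hmap⟩
    rw [hr]
    refine MeasurableSet.inter ?_ ?_
    · have : Measurable fun ν : ProbabilityMeasure (ℕ → unitInterval) =>
          (ν : Measure (ℕ → unitInterval)) (range F)ᶜ :=
        (Measure.measurable_coe hFm.measurableSet_range.compl).comp measurable_subtype_coe
      exact this (measurableSet_singleton 0)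
    · have : Measurable fun ν : ProbabilityMeasure (ℕ → unitInterval) =>
          ∫⁻ y, edist x y ^ p.toReal ∂((ν : Measure (ℕ → unitInterval)).comap F) := by
        refine (Measure.measurable_lintegral (by fun_prop)).comp (Measurable.comp (g := fun m :
          Measure (ℕ → unitInterval) => m.comap F) ?_ measurable_subtype_coe)
        refine Measure.measurable_of_measurable_coe _ fun S hS => ?_
        simp only [hFm.comap_apply]
        exact Measure.measurable_coe (hFm.measurableSet_image' hS)
      exact this measurableSet_Iio

end PSpace

/-! ### Relative compactness in Wasserstein spaces -/

theorem isCompact_closure_of_forall_seq {α : Type*} [PseudoMetricSpace α] {S : Set α}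
    (h : ∀ u : ℕ → α, (∀ n, u n ∈ S) → ∃ a, ∃ φ : ℕ → ℕ, StrictMono φ ∧
      Tendsto (u ∘ φ) atTop (𝓝 a)) : IsCompact (closure S) := by
  refine IsSeqCompact.isCompact fun x hx => ?_
  choose y hyS hy using fun n => Metric.mem_closure_iff.1 (hx n) (1 / (n + 1)) (by positivity)
  obtain ⟨a, φ, hφ, ha⟩ := h y hyS
  refine ⟨a, mem_closure_of_tendsto ha (Eventually.of_forall fun n => hyS _), φ, hφ, ?_⟩
  refine tendsto_of_tendsto_of_dist (f₁ := y ∘ φ) ha ?_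
  refine squeeze_zero (fun _ => dist_nonneg) (fun n => ?_)
    (tendsto_one_div_add_atTop_nhds_zero_nat.comp hφ.tendsto_atTop)
  simpa [dist_comm] using (hy (φ n)).le

/-- A measurable function with relatively compact sublevel sets which grows faster than the `p`-th
power of the distance to `x`. Over a complete separable space, a subset of `𝒫_p` is relatively
compact if and only if the integrals of some such function are bounded on it. -/
structure IsMomentCoercive (p : ℝ≥0∞) {X : Type*} [MetricSpace X] [MeasurableSpace X] (x : X)
    (Φ : X → ℝ≥0∞) : Prop where
  measurable : Measurable Φ
  exists_isCompact (R : ℝ≥0) : ∃ C, IsCompact C ∧ ∀ y, Φ y ≤ R → y ∈ C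
  exists_le (k : ℕ) : ∃ R : ℝ≥0, ∀ y, k * edist x y ^ p.toReal ≤ Φ y + R

namespace PSpace

variable {p : ℝ≥0∞} [Fact (1 ≤ p)] [Fact (p ≠ ∞)]
  {X : Type*} [MeasurableSpace X] [MetricSpace X] [SecondCountableTopology X] [BorelSpace X]

theorem isTightMeasureSet_of_isMomentCoercive {x : X} {Φ : X → ℝ≥0∞} (hΦ : IsMomentCoercive p x Φ) (R : ℝ≥0) :
    IsTightMeasureSet {μ : Measure X | ∫⁻ y, Φ y ∂μ ≤ R} := by
  rw [isTightMeasureSet_iff_exists_isCompact_measure_compl_le]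
  intro ε hε
  rcases eq_or_ne ε ∞ with rfl | hε'
  · exact ⟨∅, isCompact_empty, fun _ _ => le_top⟩
  lift ε to ℝ≥0 using hε'
  have hε0 : 0 < ε := by exact_mod_cast hε
  have hM : 0 < (R + 1) / ε := by positivity
  obtain ⟨C, hC, h⟩ := hΦ.exists_isCompact ((R + 1) / ε)
  refine ⟨C, hC, fun μ hμ => ?_⟩
  calc μ Cᶜ ≤ μ {y | (((R + 1) / ε : ℝ≥0) : ℝ≥0∞) ≤ Φ y} := by
        refine measure_mono fun y hy => ?_
        by_contra h'
        exact hy (h y (not_le.1 h').le)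
    _ ≤ (∫⁻ y, Φ y ∂μ) / ((R + 1) / ε : ℝ≥0) :=
        meas_ge_le_lintegral_div hΦ.measurable.aemeasurable (by exact_mod_cast hM.ne') (by simp)
    _ ≤ R / ((R + 1) / ε : ℝ≥0) := by gcongr; exact hμ
    _ = ((R / ((R + 1) / ε) : ℝ≥0) : ℝ≥0∞) := (ENNReal.coe_div hM.ne').symm
    _ ≤ ε := by
        rw [ENNReal.coe_le_coe, div_div_eq_mul_div]
        refine div_le_of_le_mul₀ (by positivity) (by positivity) ?_
        rw [mul_comm]
        gcongr
        simp

variable [StandardBorelSpace X]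

/-- A bound for the integral of a coercive function yields tightness, hence a weakly convergent
subsequence, and the uniform integrability which makes the moments converge. -/
theorem isCompact_closure_of_isMomentCoercive {x : X} {Φ : X → ℝ≥0∞} (hΦ : IsMomentCoercive p x Φ) (R : ℝ≥0) :
    IsCompact (closure {μ : PSpace p X | ∫⁻ y, Φ y ∂μ.toMeasure ≤ R}) := by
  let a : X → ℝ≥0∞ := fun y => edist x y ^ p.toReal
  have ha : Continuous a := by fun_prop
  refine isCompact_closure_of_forall_seq fun u hu => ?_
  have htight : IsTightMeasureSet {((μ : ProbabilityMeasure X) : Measure X) |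
      μ ∈ range fun n => (u n).1} := by
    refine (isTightMeasureSet_of_isMomentCoercive hΦ R).subset ?_
    rintro _ ⟨_, ⟨n, rfl⟩, rfl⟩
    exact hu n
  obtain ⟨μ, -, φ, hφ, hμ⟩ := (isCompact_closure_of_isTightMeasureSet htight).isSeqCompact
    (fun n => subset_closure (mem_range_self n))
  have hmin := fun M : ℝ≥0 => tendsto_lintegral_min_of_tendsto hμ ha M
  -- beyond a suitable level, the excess of the `p`-th power of the distance is dominated by `Φ / k`
  have hexc : ∀ k : ℕ, 0 < k → ∃ M : ℝ≥0, ∀ n,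
      ∫⁻ y, a y ∂(u n).toMeasure ≤ ∫⁻ y, min (a y) M ∂(u n).toMeasure + R / k := by
    intro k hk
    have hk0 : (k : ℝ≥0∞) ≠ 0 := by exact_mod_cast hk.ne'
    have hkt : (k : ℝ≥0∞) ≠ ∞ := ENNReal.natCast_ne_top k
    obtain ⟨M, hM⟩ := hΦ.exists_le k
    refine ⟨M / k, fun n => ?_⟩
    have hpt : ∀ y, a y ≤ min (a y) (M / k : ℝ≥0) + Φ y / k := by
      intro y
      rcases le_total (a y) (M / k : ℝ≥0) with h | h
      · rw [min_eq_left h]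
        exact le_self_add
      · rw [min_eq_right h, ENNReal.coe_div (by exact_mod_cast hk.ne'), ENNReal.coe_natCast,
          ← ENNReal.add_div, ENNReal.le_div_iff_mul_le (Or.inl hk0) (Or.inl hkt), mul_comm,
          add_comm]
        exact hM y
    calc ∫⁻ y, a y ∂(u n).toMeasure ≤ ∫⁻ y, (min (a y) (M / k : ℝ≥0) + Φ y / k) ∂(u n).toMeasure :=
          lintegral_mono hpt
      _ = ∫⁻ y, min (a y) (M / k : ℝ≥0) ∂(u n).toMeasure + (∫⁻ y, Φ y ∂(u n).toMeasure) / k := by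
          rw [lintegral_add_left (by fun_prop)]
          simp only [div_eq_mul_inv]
          rw [lintegral_mul_const _ hΦ.measurable]
      _ ≤ _ := by
          gcongr
          exact hu n
  have hsup : ∫⁻ y, a y ∂(μ : Measure X) = ⨆ n : ℕ, ∫⁻ y, min (a y) (n : ℝ≥0) ∂(μ : Measure X) := by
    rw [← lintegral_iSup (f := fun (n : ℕ) y => min (a y) (n : ℝ≥0)) (fun n => by fun_prop)
      fun m n hmn y => min_le_min le_rfl (ENNReal.coe_le_coe.2 (Nat.cast_le.2 hmn))]
    refine lintegral_congr fun y => ?_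
    refine le_antisymm ?_ (iSup_le fun n => min_le_left _ _)
    refine le_of_forall_lt fun c hc => ?_
    obtain ⟨n, hn⟩ := ENNReal.exists_nat_gt hc.ne_top
    exact lt_iSup_iff.2 ⟨n, lt_min hc (by exact_mod_cast hn)⟩
  have hfin : ∫⁻ y, a y ∂(μ : Measure X) < ∞ := by
    obtain ⟨M, hM⟩ := hexc 1 one_pos
    have hB : ∀ n, ∫⁻ y, a y ∂(u n).toMeasure ≤ M + R := fun n => by
      refine (hM n).trans ?_
      gcongr
      · refine (lintegral_mono fun y => min_le_right _ _).trans ?_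
        simp
      · simp
    rw [hsup]
    refine (iSup_le fun n => ?_).trans_lt (show (M + R : ℝ≥0∞) < ∞ by simp)
    exact le_of_tendsto (hmin n) (Eventually.of_forall fun i =>
      (lintegral_mono fun y => min_le_left _ _).trans (hB _))
  refine ⟨⟨μ, x, hfin⟩, φ, hφ, (tendsto_nhds_iff x).2 ⟨hμ, ?_⟩⟩
  change Tendsto _ _ (𝓝 (∫⁻ y, a y ∂(μ : Measure X)))
  refine tendsto_order.2 ⟨fun b hb => ?_, fun b hb => ?_⟩
  · rw [hsup, lt_iSup_iff] at hb
    obtain ⟨n, hn⟩ := hb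
    filter_upwards [(hmin n).eventually_const_lt hn] with i hi
    exact hi.trans_le (lintegral_mono fun y => min_le_left _ _)
  · obtain ⟨k, hk0, hk⟩ : ∃ k : ℕ, 0 < k ∧ ∫⁻ y, a y ∂(μ : Measure X) + R / k < b := by
      have h1 : Tendsto (fun k : ℕ => ∫⁻ y, a y ∂(μ : Measure X) + (R : ℝ≥0∞) / k) atTop
          (𝓝 (∫⁻ y, a y ∂(μ : Measure X) + 0)) := by
        refine tendsto_const_nhds.add ?_
        have := ENNReal.Tendsto.const_mul (a := (R : ℝ≥0∞)) ENNReal.tendsto_inv_nat_nhds_zero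
          (Or.inr ENNReal.coe_ne_top)
        simpa [div_eq_mul_inv] using this
      rw [add_zero] at h1
      obtain ⟨k, h2, h3⟩ := ((eventually_gt_atTop 0).and (h1.eventually_lt_const hb)).exists
      exact ⟨k, h2, h3⟩
    obtain ⟨M, hM⟩ := hexc k hk0
    have hlim := (hmin M).add (tendsto_const_nhds (x := (R : ℝ≥0∞) / k))
    have hlt : ∫⁻ y, min (a y) M ∂(μ : Measure X) + R / k < b :=
      (add_le_add (lintegral_mono fun y => min_le_left _ _) le_rfl).trans_lt hk
    filter_upwards [hlim.eventually_lt_const hlt] with i hi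
    exact (hM _).trans_lt hi

/-- The tail of the distance to a point varies in `L^p` by no more than the Wasserstein
distance. -/
theorem lpSize_tsub_le (x : X) (M : ℝ≥0) (μ ν : PSpace p X) :
    lpSize p (fun y => edist x y - M) μ.toMeasure ≤
      lpSize p (fun y => edist x y - M) ν.toMeasure + edist μ ν := by
  refine le_of_forall_gt fun c hc => ?_
  obtain ⟨d, hd, hdc⟩ : ∃ d, edist μ ν < d ∧
      lpSize p (fun y => edist x y - M) ν.toMeasure + d ≤ c := by
    refine ⟨c - lpSize p (fun y => edist x y - M) ν.toMeasure, lt_tsub_iff_left.2 hc, ?_⟩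
    exact (add_tsub_cancel_of_le (le_self_add.trans hc.le)).le
  obtain ⟨γ, hγ, hlt⟩ := exists_isCoupling_lt hd
  refine lt_of_lt_of_le ?_ hdc
  have hfin : lpSize p (fun y => edist x y - M) ν.toMeasure ≠ ∞ := by
    have := (le_self_add.trans_lt hc).ne_top
    exact this
  refine lt_of_le_of_lt ?_ (ENNReal.add_lt_add_left hfin hlt)
  rw [← hγ.map_fst, ← hγ.map_snd, lpSize_map (by fun_prop) measurable_fst,
    lpSize_map (by fun_prop) measurable_snd]
  refine (lpSize_mono fun z => ?_).trans (lpSize_add_le (by fun_prop) (by fun_prop))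
  rw [tsub_le_iff_right, add_right_comm]
  calc edist x z.1 ≤ edist x z.2 + edist z.1 z.2 := by
        rw [edist_comm z.1]; exact edist_triangle _ _ _
    _ ≤ _ := by gcongr; exact le_tsub_add

/-- Relatively compact sets have uniformly integrable `p`-th moments. -/
theorem exists_forall_lintegral_tsub_rpow_le {K : Set (PSpace p X)} (hK : IsCompact (closure K))
    (x : X) {ε : ℝ≥0∞} (hε : 0 < ε) :
    ∃ M : ℝ≥0, ∀ μ ∈ K, ∫⁻ y, (edist x y - M) ^ p.toReal ∂μ.toMeasure ≤ ε := by
  have hq := toReal_pos_of_fact p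
  let c : ℝ≥0∞ := ε ^ (1 / p.toReal)
  have hc : 0 < c := ENNReal.rpow_pos_of_nonneg hε (by positivity)
  have hc2 : 0 < c / 2 := ENNReal.half_pos hc.ne'
  have hcε : c ^ p.toReal = ε := by
    rw [← ENNReal.rpow_mul, one_div_mul_cancel hq.ne', ENNReal.rpow_one]
  obtain ⟨t, ht, hcov⟩ := EMetric.totallyBounded_iff.1
    (hK.totallyBounded.subset subset_closure) (c / 2) hc2
  have hM : ∀ ν : PSpace p X, ∃ M : ℝ≥0, lpSize p (fun y => edist x y - M) ν.toMeasure < c / 2 := by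
    intro ν
    obtain ⟨M, hM⟩ := exists_lintegral_tsub_rpow_lt (μ := ν.toMeasure) (f := fun y => edist x y)
      (by fun_prop) hq (lintegral_edist_rpow_lt_top x ν).ne (ENNReal.rpow_pos_of_nonneg hc2 hq.le)
    refine ⟨M, ?_⟩
    rwa [← lpSize_rpow, ENNReal.rpow_lt_rpow_iff hq] at hM
  choose M hM using hM
  refine ⟨ht.toFinset.sup M, fun μ hμ => ?_⟩
  obtain ⟨ν, hν, hμν⟩ := mem_iUnion₂.1 (hcov hμ)
  rw [← hcε, ← lpSize_le_iff]
  calc lpSize p (fun y => edist x y - (ht.toFinset.sup M : ℝ≥0)) μ.toMeasure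
      ≤ lpSize p (fun y => edist x y - M ν) μ.toMeasure := by
        refine lpSize_mono fun y => tsub_le_tsub_left ?_ _
        exact_mod_cast Finset.le_sup (ht.mem_toFinset.2 hν)
    _ ≤ lpSize p (fun y => edist x y - M ν) ν.toMeasure + edist μ ν := lpSize_tsub_le _ _ _ _
    _ ≤ c / 2 + c / 2 := add_le_add (hM ν).le (le_of_lt hμν)
    _ = c := ENNReal.add_halves c

/-- Relatively compact sets are tight, also with respect to the weight `1 + ρ(x, ·)^p`. -/
theorem exists_isCompact_lintegral_compl_le [CompleteSpace X] {K : Set (PSpace p X)}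
    (hK : IsCompact (closure K)) (x : X) {ε : ℝ≥0∞} (hε : 0 < ε) :
    ∃ C, IsCompact C ∧ ∀ μ ∈ K, ∫⁻ y in Cᶜ, (1 + edist x y ^ p.toReal) ∂μ.toMeasure ≤ ε := by
  have hq := one_le_toReal_of_fact p
  let c : ℝ≥0∞ := 2 ^ (p.toReal - 1)
  have hc : c ≠ ∞ := (ENNReal.rpow_lt_top_of_nonneg (by linarith) (by simp)).ne
  have hc0 : c ≠ 0 := (ENNReal.rpow_pos_of_nonneg (by simp) (by linarith)).ne'
  have hε2 : 0 < ε / 2 := ENNReal.half_pos hε.ne'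
  obtain ⟨M, hM⟩ := exists_forall_lintegral_tsub_rpow_le hK x
    (ENNReal.div_pos hε2.ne' hc)
  have hMq : (M : ℝ≥0∞) ^ p.toReal ≠ ∞ := ENNReal.rpow_ne_top_of_nonneg (by linarith) (by simp)
  have hweak : IsCompact (closure ((fun μ : PSpace p X => μ.1) '' K)) :=
    (hK.image continuous_val).closure_of_subset (image_mono subset_closure)
  obtain ⟨C, hC, hCK⟩ := isTightMeasureSet_iff_exists_isCompact_measure_compl_le.1
    (isTightMeasureSet_of_isCompact_closure hweak) (ε / 2 / (1 + c * M ^ p.toReal))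
    (ENNReal.div_pos hε2.ne' (ENNReal.add_ne_top.2 ⟨by simp, ENNReal.mul_ne_top hc hMq⟩))
  refine ⟨C, hC, fun μ hμ => ?_⟩
  have hμC : μ.toMeasure Cᶜ ≤ ε / 2 / (1 + c * M ^ p.toReal) := hCK _ ⟨_, ⟨μ, hμ, rfl⟩, rfl⟩
  calc ∫⁻ y in Cᶜ, (1 + edist x y ^ p.toReal) ∂μ.toMeasure
      ≤ ∫⁻ y in Cᶜ, (c * (edist x y - M) ^ p.toReal + (1 + c * M ^ p.toReal)) ∂μ.toMeasure := by
        refine lintegral_mono fun y => ?_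
        calc 1 + edist x y ^ p.toReal ≤ 1 + ((edist x y - M) + M) ^ p.toReal := by
              gcongr
              exact le_tsub_add
          _ ≤ 1 + c * ((edist x y - M) ^ p.toReal + M ^ p.toReal) := by
              gcongr
              exact ENNReal.rpow_add_le_mul_rpow_add_rpow _ _ hq
          _ = _ := by ring
    _ = c * ∫⁻ y in Cᶜ, (edist x y - M) ^ p.toReal ∂μ.toMeasure +
          (1 + c * M ^ p.toReal) * μ.toMeasure Cᶜ := by
        rw [lintegral_add_right _ measurable_const, lintegral_const_mul' _ _ hc,
          lintegral_const, Measure.restrict_apply_univ]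
    _ ≤ c * (ε / 2 / c) + (1 + c * M ^ p.toReal) * (ε / 2 / (1 + c * M ^ p.toReal)) := by
        gcongr
        exact (setLIntegral_le_lintegral _ _).trans (hM μ hμ)
    _ ≤ ε / 2 + ε / 2 := add_le_add ENNReal.mul_div_le ENNReal.mul_div_le
    _ = ε := ENNReal.add_halves ε

/-- On a relatively compact set of measures, some coercive function has bounded integrals, and the
same is true for the images under a nonexpansive map. -/
theorem exists_isMomentCoercive [CompleteSpace X] {Y : Type*} [MetricSpace Y] [MeasurableSpace Y]
    [BorelSpace Y] {K : Set (PSpace p X)} (hK : IsCompact (closure K)) {f : X → Y}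
    (hf : LipschitzWith 1 f) (x : X) :
    ∃ Φ : Y → ℝ≥0∞, IsMomentCoercive p (f x) Φ ∧
      ∃ R : ℝ≥0, ∀ μ ∈ K, ∫⁻ y, Φ (f y) ∂μ.toMeasure ≤ R := by
  have hq := toReal_pos_of_fact p
  obtain ⟨ε, hε, hεsum⟩ := ENNReal.exists_pos_sum_of_countable one_ne_zero ℕ
  choose C hC hCK using fun n : ℕ => exists_isCompact_lintegral_compl_le hK x
    (show (0 : ℝ≥0∞) < ε n by exact_mod_cast hε n)
  let b : Y → ℝ≥0∞ := fun y => 1 + edist (f x) y ^ p.toReal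
  have hb : Measurable b := by fun_prop
  have hD : ∀ n, IsCompact (f '' C n) := fun n => (hC n).image hf.continuous
  have hbm : ∀ n, Measurable ((f '' C n)ᶜ.indicator b) := fun n =>
    hb.indicator (hD n).isClosed.measurableSet.compl
  -- each compact set that is left adds the weight `b`, and the integrals of the summands over the
  -- measures in `K` are bounded by a summable sequence
  let Φ : Y → ℝ≥0∞ := fun y => ∑' n, (f '' C n)ᶜ.indicator b y
  have hlow : ∀ n y, y ∉ ⋃ k ∈ Finset.range n, f '' C k → n * b y ≤ Φ y := by
    intro n y hy
    calc n * b y = ∑ k ∈ Finset.range n, (f '' C k)ᶜ.indicator b y := by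
          rw [Finset.sum_congr rfl fun k hk => indicator_of_mem (s := (f '' C k)ᶜ) ?_ b]
          · simp
          · exact fun h => hy (mem_iUnion₂.2 ⟨k, hk, h⟩)
      _ ≤ Φ y := ENNReal.sum_le_tsum _
  have hDn : ∀ n : ℕ, IsCompact (⋃ k ∈ Finset.range n, f '' C k) := fun n =>
    (Finset.range n).isCompact_biUnion fun k _ => hD k
  refine ⟨Φ, ⟨Measurable.tsum hbm, fun R => ?_, fun k => ?_⟩, 1, fun μ hμ => ?_⟩
  · obtain ⟨n, hn⟩ := exists_nat_gt R
    refine ⟨_, hDn n, fun y hy => ?_⟩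
    by_contra h
    have h1 : (R : ℝ≥0∞) < n := by exact_mod_cast hn
    have h2 : (n : ℝ≥0∞) ≤ n * b y := le_mul_of_one_le_right' le_self_add
    exact absurd (h1.trans_le (h2.trans (hlow n y h))) (not_lt.2 hy)
  · obtain ⟨r, hr⟩ := (hDn k).isBounded.subset_closedBall (f x)
    refine ⟨k * r.toNNReal ^ p.toReal, fun y => ?_⟩
    by_cases hy : y ∈ ⋃ j ∈ Finset.range k, f '' C j
    · refine le_add_left ?_
      rw [ENNReal.coe_mul, ENNReal.coe_natCast, ENNReal.coe_rpow_of_nonneg _ hq.le]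
      gcongr
      rw [edist_comm, edist_dist]
      exact ENNReal.ofReal_le_ofReal (Metric.mem_closedBall.1 (hr hy))
    · refine le_add_right (le_trans ?_ (hlow k y hy))
      gcongr
      exact le_add_self
  · calc ∫⁻ y, Φ (f y) ∂μ.toMeasure = ∑' n, ∫⁻ y, (f '' C n)ᶜ.indicator b (f y) ∂μ.toMeasure :=
          lintegral_tsum fun n => ((hbm n).comp hf.continuous.measurable).aemeasurable
      _ ≤ ∑' n, (ε n : ℝ≥0∞) := by
          refine ENNReal.tsum_le_tsum fun n => le_trans ?_ (hCK n μ hμ)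
          rw [← lintegral_indicator (hC n).isClosed.measurableSet.compl]
          refine lintegral_mono fun y => ?_
          by_cases hy : y ∈ C n
          · have : f y ∉ (f '' C n)ᶜ := fun h => h (mem_image_of_mem f hy)
            simp only [indicator_of_notMem this, zero_le]
          · rw [indicator_of_mem (show y ∈ (C n)ᶜ from hy)]
            refine (indicator_le_self _ _ _).trans ?_
            change 1 + edist (f x) (f y) ^ p.toReal ≤ _
            gcongr
            simpa using hf x y
      _ ≤ ((1 : ℝ≥0) : ℝ≥0∞) := by simpa using hεsum.le

end PSpace

namespace IsMomentCoercive

variable {p : ℝ≥0∞} [Fact (1 ≤ p)] [Fact (p ≠ ∞)]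
  {X : Type*} [MeasurableSpace X] [MetricSpace X] [SecondCountableTopology X] [BorelSpace X]

/-- Coercivity passes to the space of measures. -/
theorem lintegral [StandardBorelSpace X] {x : X} {Φ : X → ℝ≥0∞} (h : IsMomentCoercive p x Φ) :
    IsMomentCoercive p (PSpace.dirac p x) fun μ : PSpace p X => ∫⁻ y, Φ y ∂μ.toMeasure where
  measurable := PSpace.measurable_lintegral h.measurable
  exists_isCompact R := ⟨_, PSpace.isCompact_closure_of_isMomentCoercive h R, fun _ hμ =>
    subset_closure hμ⟩
  exists_le k := by
    obtain ⟨R, hR⟩ := h.exists_le k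
    refine ⟨R, fun μ => ?_⟩
    rw [PSpace.edist_dirac_rpow, ← lintegral_const_mul' _ _ (ENNReal.natCast_ne_top k)]
    refine (lintegral_mono hR).trans ?_
    rw [lintegral_add_right _ measurable_const]
    simp

theorem prod {Y : Type*} [MeasurableSpace Y] [MetricSpace Y]
    {x : X} {Φ : X → ℝ≥0∞} (hΦ : IsMomentCoercive p x Φ) {y : Y} {Ψ : Y → ℝ≥0∞}
    (hΨ : IsMomentCoercive p y Ψ) :
    IsMomentCoercive p (WithLp.toLp p (x, y)) fun w : WithLp p (X × Y) => Φ w.fst + Ψ w.snd where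
  measurable := by
    have h1 : Measurable fun w : WithLp p (X × Y) => w.fst :=
      measurable_fst.comp (WithLp.measurable_ofLp p (X × Y))
    have h2 : Measurable fun w : WithLp p (X × Y) => w.snd :=
      measurable_snd.comp (WithLp.measurable_ofLp p (X × Y))
    exact (hΦ.measurable.comp h1).add (hΨ.measurable.comp h2)
  exists_isCompact R := by
    obtain ⟨C, hC, hCR⟩ := hΦ.exists_isCompact R
    obtain ⟨D, hD, hDR⟩ := hΨ.exists_isCompact R
    refine ⟨WithLp.toLp p '' C ×ˢ D, (hC.prod hD).image (WithLp.prod_continuous_toLp p X Y),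
      fun w hw => ⟨(w.fst, w.snd), ⟨hCR _ (le_self_add.trans hw), hDR _ (le_add_self.trans hw)⟩, rfl⟩⟩
  exists_le k := by
    have hq := toReal_pos_of_fact p
    obtain ⟨R, hR⟩ := hΦ.exists_le k
    obtain ⟨S, hS⟩ := hΨ.exists_le k
    refine ⟨R + S, fun w => ?_⟩
    rw [WithLp.prod_edist_eq_add hq, ← ENNReal.rpow_mul, one_div_mul_cancel hq.ne',
      ENNReal.rpow_one, mul_add, ENNReal.coe_add, add_add_add_comm]
    exact add_le_add (hR _) (hS _)

end IsMomentCoercive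

/-! ### The modulus of continuity -/

section WithLp

variable {p : ℝ≥0∞} {X Y : Type*} [MeasurableSpace X] [MeasurableSpace Y]

@[fun_prop]
theorem WithLp.measurable_fst : Measurable fun w : WithLp p (X × Y) => w.fst :=
  _root_.measurable_fst.comp (WithLp.measurable_ofLp p (X × Y))

@[fun_prop]
theorem WithLp.measurable_snd : Measurable fun w : WithLp p (X × Y) => w.snd :=
  _root_.measurable_snd.comp (WithLp.measurable_ofLp p (X × Y))

variable [Fact (1 ≤ p)] [Fact (p ≠ ∞)]

theorem WithLp.edist_rpow_eq_add [EDist X] [EDist Y] (v w : WithLp p (X × Y)) :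
    edist v w ^ p.toReal = edist v.fst w.fst ^ p.toReal + edist v.snd w.snd ^ p.toReal := by
  have hq := toReal_pos_of_fact p
  rw [WithLp.prod_edist_eq_add hq, ← ENNReal.rpow_mul, one_div_mul_cancel hq.ne', ENNReal.rpow_one]

theorem WithLp.edist_fst_le_edist [EDist X] [EDist Y] (v w : WithLp p (X × Y)) :
    edist v.fst w.fst ≤ edist v w := by
  rw [← ENNReal.rpow_le_rpow_iff (toReal_pos_of_fact p), WithLp.edist_rpow_eq_add]
  exact le_self_add

theorem WithLp.edist_snd_le_edist [EDist X] [EDist Y] (v w : WithLp p (X × Y)) :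
    edist v.snd w.snd ≤ edist v w := by
  rw [← ENNReal.rpow_le_rpow_iff (toReal_pos_of_fact p), WithLp.edist_rpow_eq_add]
  exact le_add_self

end WithLp

section ModulusOfContinuity

variable {p : ℝ≥0∞} [Fact (1 ≤ p)] [Fact (p ≠ ∞)]

/-- A partial self-coupling of `ν` can be transported to a partial self-coupling of a nearby
measure `μ`, by gluing couplings of `ν` and `μ` to both of its ends. -/
theorem exists_transport {W : Type*} [MetricSpace W] [SecondCountableTopology W] [MeasurableSpace W]
    [BorelSpace W] [StandardBorelSpace W] {μ ν : PSpace p W} {ε : ℝ≥0} (h : edist ν μ < ε)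
    (γ : Measure (W × W)) (h₁ : γ.map Prod.fst ≤ ν.toMeasure) (h₂ : γ.map Prod.snd ≤ ν.toMeasure) :
    ∃ γ' : Measure (W × W), γ' univ = γ univ ∧ γ'.map Prod.fst ≤ μ.toMeasure ∧
      γ'.map Prod.snd ≤ μ.toMeasure ∧ ∀ D : W → W → ℝ≥0∞, Measurable (fun z : W × W => D z.1 z.2) →
        (∀ v w, D v w = D w v) → (∀ u v w, D u w ≤ D u v + D v w) → (∀ v w, D v w ≤ edist v w) →
        lpSize p (fun z => D z.1 z.2) γ' ≤ lpSize p (fun z => D z.1 z.2) γ + 2 * ε ∧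
        lpSize p (fun z => D z.1 z.2) γ ≤ lpSize p (fun z => D z.1 z.2) γ' + 2 * ε := by
  obtain ⟨π, hπ, hlt⟩ := PSpace.exists_isCoupling_lt h
  have := hπ.isProbabilityMeasure
  have : Nonempty W := μ.1.nonempty
  have hγ : IsFiniteMeasure γ := by
    have := isFiniteMeasure_of_le ν.toMeasure h₁
    refine ⟨?_⟩
    have := measure_lt_top (γ.map Prod.fst) univ
    rwa [Measure.map_apply measurable_fst MeasurableSet.univ] at this
  obtain ⟨θ₁, hθ₁, hθ₁π, -⟩ := exists_glue γ measurable_fst π (h₁.trans_eq hπ.map_fst.symm)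
  have hθ₁f : IsFiniteMeasure θ₁ := by
    refine ⟨?_⟩
    have := measure_lt_top γ univ
    rwa [← hθ₁, Measure.map_apply measurable_fst MeasurableSet.univ] at this
  have hsnd : θ₁.map (fun ω => ω.1.2) ≤ π.map Prod.fst := by
    have : θ₁.map (fun ω => ω.1.2) = γ.map Prod.snd := by
      rw [← hθ₁, Measure.map_map (by fun_prop) (by fun_prop)]
      rfl
    rw [this, hπ.map_fst]
    exact h₂
  obtain ⟨θ, hθ, hθπ, -⟩ := exists_glue θ₁ (by fun_prop) π hsnd
  have hθ₁π' : θ.map (fun ω => (ω.1.1.1, ω.1.2)) ≤ π := by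
    rw [← hθ, Measure.map_map (by fun_prop) (by fun_prop)] at hθ₁π
    exact hθ₁π
  have hθγ : θ.map (fun ω => ω.1.1) = γ := by
    rw [← hθ₁, ← hθ, Measure.map_map (by fun_prop) (by fun_prop)]
    rfl
  refine ⟨θ.map fun ω => (ω.1.2, ω.2), ?_, ?_, ?_, fun D hD hsymm htri hle => ?_⟩
  · conv_rhs => rw [← hθγ]
    rw [Measure.map_apply (by fun_prop) MeasurableSet.univ,
      Measure.map_apply (by fun_prop) MeasurableSet.univ]
    rfl
  · have h3 := Measure.map_mono hθ₁π' measurable_snd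
    rw [hπ.map_snd, Measure.map_map (by fun_prop) (by fun_prop)] at h3
    rwa [Measure.map_map (by fun_prop) (by fun_prop)]
  · have h3 := Measure.map_mono hθπ measurable_snd
    rw [hπ.map_snd, Measure.map_map (by fun_prop) (by fun_prop)] at h3
    rwa [Measure.map_map (by fun_prop) (by fun_prop)]
  · have hDπ : lpSize p (fun z => D z.1 z.2) π ≤ ε := (lpSize_mono fun z => hle _ _).trans hlt.le
    have e₁ : lpSize p (fun ω => D ω.1.1.1 ω.1.2) θ ≤ ε := by
      have := lpSize_map (p := p) (γ := θ) (g := fun ω : ((W × W) × W) × W => (ω.1.1.1, ω.1.2)) hD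
        (by fun_prop)
      rw [← this]
      exact (lpSize_mono_measure hθ₁π').trans hDπ
    have e₂ : lpSize p (fun ω => D ω.1.1.2 ω.2) θ ≤ ε := by
      have := lpSize_map (p := p) (γ := θ) (g := fun ω : ((W × W) × W) × W => (ω.1.1.2, ω.2)) hD
        (by fun_prop)
      rw [← this]
      exact (lpSize_mono_measure hθπ).trans hDπ
    have e₃ : lpSize p (fun z => D z.1 z.2) γ = lpSize p (fun ω => D ω.1.1.1 ω.1.1.2) θ := by
      rw [← hθγ, lpSize_map hD (by fun_prop)]
    rw [lpSize_map hD (by fun_prop), e₃]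
    have m₁ : Measurable fun ω : ((W × W) × W) × W => D ω.1.1.1 ω.1.2 :=
      hD.comp (g := fun z : W × W => D z.1 z.2)
        (f := fun ω : ((W × W) × W) × W => (ω.1.1.1, ω.1.2)) (by fun_prop)
    have m₂ : Measurable fun ω : ((W × W) × W) × W => D ω.1.1.2 ω.2 :=
      hD.comp (g := fun z : W × W => D z.1 z.2)
        (f := fun ω : ((W × W) × W) × W => (ω.1.1.2, ω.2)) (by fun_prop)
    have m₃ : Measurable fun ω : ((W × W) × W) × W => D ω.1.1.1 ω.1.1.2 :=
      hD.comp (g := fun z : W × W => D z.1 z.2)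
        (f := fun ω : ((W × W) × W) × W => (ω.1.1.1, ω.1.1.2)) (by fun_prop)
    have m₄ : Measurable fun ω : ((W × W) × W) × W => D ω.1.2 ω.2 :=
      hD.comp (g := fun z : W × W => D z.1 z.2)
        (f := fun ω : ((W × W) × W) × W => (ω.1.2, ω.2)) (by fun_prop)
    constructor
    · refine (lpSize_mono (g := fun ω => D ω.1.1.1 ω.1.1.2 + D ω.1.1.1 ω.1.2 + D ω.1.1.2 ω.2)
        fun ω => ?_).trans ((lpSize_add_three_le m₃.aemeasurable m₁.aemeasurable
          m₂.aemeasurable).trans ?_)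
      · calc D ω.1.2 ω.2 ≤ D ω.1.2 ω.1.1.1 + D ω.1.1.1 ω.2 := htri _ _ _
          _ ≤ D ω.1.1.1 ω.1.2 + (D ω.1.1.1 ω.1.1.2 + D ω.1.1.2 ω.2) := by
              rw [hsymm ω.1.2]
              gcongr
              exact htri _ _ _
          _ = _ := by ring
      · rw [add_assoc, two_mul]
        gcongr
    · refine (lpSize_mono (g := fun ω => D ω.1.2 ω.2 + D ω.1.1.1 ω.1.2 + D ω.1.1.2 ω.2)
        fun ω => ?_).trans ((lpSize_add_three_le m₄.aemeasurable m₁.aemeasurable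
          m₂.aemeasurable).trans ?_)
      · calc D ω.1.1.1 ω.1.1.2 ≤ D ω.1.1.1 ω.1.2 + D ω.1.2 ω.1.1.2 := htri _ _ _
          _ ≤ D ω.1.1.1 ω.1.2 + (D ω.1.2 ω.2 + D ω.1.1.2 ω.2) := by
              rw [hsymm ω.1.1.2]
              gcongr
              exact htri _ _ _
          _ = _ := by ring
      · rw [add_assoc, two_mul]
        gcongr

variable {X Y : Type*} [MetricSpace X] [SecondCountableTopology X] [MeasurableSpace X]
  [BorelSpace X] [StandardBorelSpace X] [MetricSpace Y] [SecondCountableTopology Y]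
  [MeasurableSpace Y] [BorelSpace Y] [StandardBorelSpace Y]

theorem modulus_mono (P : PSpace p (WithLp p (X × Y))) {δ δ' : ℝ≥0} (h : δ ≤ δ') :
    modulus P δ ≤ modulus P δ' :=
  biSup_mono fun _ hγ => ⟨hγ.1, hγ.2.1, hγ.2.2.1, hγ.2.2.2.trans (by exact_mod_cast h)⟩

/-- The modulus of continuity depends semicontinuously on the measure. -/
theorem modulus_le_of_edist_lt {P Q : PSpace p (WithLp p (X × Y))} {ε : ℝ≥0} (h : edist Q P < ε)
    (δ : ℝ≥0) : modulus Q δ ≤ modulus P (δ + 2 * ε) + 2 * ε := by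
  refine iSup₂_le fun γ ⟨hγ1, hγ₁, hγ₂, hγδ⟩ => ?_
  obtain ⟨γ', hu, hγ'₁, hγ'₂, hD⟩ := exists_transport h γ hγ₁ hγ₂
  have hfst := hD (fun v w => edist v.fst w.fst) (by fun_prop) (fun _ _ => edist_comm _ _)
    (fun _ _ _ => edist_triangle _ _ _) WithLp.edist_fst_le_edist
  have hsnd := hD (fun v w => edist v.snd w.snd) (by fun_prop) (fun _ _ => edist_comm _ _)
    (fun _ _ _ => edist_triangle _ _ _) WithLp.edist_snd_le_edist
  have hmem : γ' ∈ shifts P (δ + 2 * ε) := by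
    refine ⟨hu.trans_le hγ1, hγ'₁, hγ'₂, hfst.1.trans ?_⟩
    push_cast
    gcongr
    exact hγδ
  refine hsnd.2.trans ?_
  gcongr
  exact le_iSup₂_of_le γ' hmem le_rfl

/-- A bounded continuous function displaces little if its argument does, uniformly over all
displacements starting from a given law: up to little mass the starting point lies in a compact
set, near which the function is uniformly continuous. -/
theorem exists_forall_lpSize_edist_le [CompleteSpace X] (m : Measure X) [IsProbabilityMeasure m]
    {E : Type*} [NormedAddCommGroup E] (h : BoundedContinuousFunction X E) {η : ℝ≥0∞}
    (hη : 0 < η) :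
    ∃ δ : ℝ≥0, 0 < δ ∧ ∀ γ : Measure (X × X), γ univ ≤ 1 → γ.map Prod.fst ≤ m →
      lpSize p (fun z => edist z.1 z.2) γ ≤ δ →
      lpSize p (fun z => edist (h z.1) (h z.2)) γ ≤ η := by
  have hq := toReal_pos_of_fact p
  have hη3 : 0 < η / 3 := ENNReal.div_pos hη.ne' (by simp)
  obtain ⟨B, hB0, hB⟩ : ∃ B : ℝ≥0, 0 < B ∧ ∀ x y, edist (h x) (h y) ≤ B := by
    refine ⟨(2 * ‖h‖₊) + 1, by positivity, fun x y => ?_⟩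
    rw [edist_nndist, ENNReal.coe_le_coe, ← NNReal.coe_le_coe]
    push_cast
    exact (h.dist_le_two_norm x y).trans (by simp)
  have hBq : (B : ℝ≥0∞) ^ p.toReal ≠ ∞ := ENNReal.rpow_ne_top_of_nonneg hq.le (by simp)
  obtain ⟨C, hC, hCm⟩ := isTightMeasureSet_iff_exists_isCompact_measure_compl_le.1
    (isTightMeasureSet_singleton (μ := m)) ((η / 3) ^ p.toReal / (B : ℝ≥0∞) ^ p.toReal)
    (ENNReal.div_pos (ENNReal.rpow_pos_of_nonneg hη3 hq.le).ne' hBq)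
  have hCm := hCm m rfl
  obtain ⟨r, hr, hrC⟩ : ∃ r : ℝ≥0, 0 < r ∧ ∀ x ∈ C, ∀ y, edist x y < r →
      edist (h x) (h y) < η / 3 := by
    have hunif := hC.uniformContinuousAt_of_continuousAt h (fun x _ => h.continuous.continuousAt)
      (edist_mem_uniformity hη3)
    obtain ⟨e, he, heC⟩ := _root_.mem_uniformity_edist.1 hunif
    obtain ⟨r, hr, hre⟩ := ENNReal.lt_iff_exists_nnreal_btwn.1 he
    exact ⟨r, by exact_mod_cast hr, fun x hx y hxy => heC (hxy.trans hre) hx⟩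
  have hr0 : (r : ℝ≥0∞) ≠ 0 := by exact_mod_cast hr.ne'
  have hBr0 : (B / r : ℝ≥0∞) ≠ ∞ := ENNReal.div_ne_top (by simp) hr0
  obtain ⟨δ, hδ, hδlt⟩ := ENNReal.lt_iff_exists_nnreal_btwn.1 (ENNReal.div_pos hη3.ne' hBr0)
  refine ⟨δ, by exact_mod_cast hδ, fun γ hγ1 hγm hγδ => ?_⟩
  have hCmeas : MeasurableSet {z : X × X | z.1 ∉ C} :=
    measurable_fst hC.isClosed.measurableSet.compl
  have hpt : ∀ z : X × X, edist (h z.1) (h z.2) ≤ η / 3 +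
      {z : X × X | z.1 ∉ C}.indicator (fun _ => (B : ℝ≥0∞)) z + B / r * edist z.1 z.2 := by
    intro z
    by_cases hz : z.1 ∈ C
    · rcases lt_or_ge (edist z.1 z.2) r with hzr | hzr
      · exact (hrC _ hz _ hzr).le.trans (le_add_right le_self_add)
      · refine le_add_left ((hB _ _).trans ?_)
        calc (B : ℝ≥0∞) = B / r * r := (ENNReal.div_mul_cancel hr0 (by simp)).symm
          _ ≤ _ := by gcongr
    · refine le_add_right (le_add_left ?_)
      rw [indicator_of_mem (show z ∈ {z : X × X | z.1 ∉ C} from hz)]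
      exact hB _ _
  refine (lpSize_mono hpt).trans ((lpSize_add_three_le (by fun_prop)
    (measurable_const.indicator hCmeas).aemeasurable (by fun_prop)).trans ?_)
  have b₁ : lpSize p (fun _ : X × X => η / 3) γ ≤ η / 3 := lpSize_const_le hγ1 _
  have b₂ : lpSize p ({z : X × X | z.1 ∉ C}.indicator (fun _ => (B : ℝ≥0∞))) γ ≤ η / 3 := by
    rw [lpSize_le_iff]
    calc ∫⁻ z, ({z : X × X | z.1 ∉ C}.indicator (fun _ => (B : ℝ≥0∞))) z ^ p.toReal ∂γ
        = ∫⁻ z, {z : X × X | z.1 ∉ C}.indicator (fun _ => (B : ℝ≥0∞) ^ p.toReal) z ∂γ := by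
          refine lintegral_congr fun z => ?_
          by_cases hz : z ∈ {z : X × X | z.1 ∉ C}
          · simp only [indicator_of_mem hz]
          · simp only [indicator_of_notMem hz, ENNReal.zero_rpow_of_pos hq]
      _ = (B : ℝ≥0∞) ^ p.toReal * γ.map Prod.fst Cᶜ := by
          rw [lintegral_indicator_const hCmeas, Measure.map_apply measurable_fst
            hC.isClosed.measurableSet.compl]
          rfl
      _ ≤ (B : ℝ≥0∞) ^ p.toReal * ((η / 3) ^ p.toReal / (B : ℝ≥0∞) ^ p.toReal) := by
          gcongr
          exact (hγm _).trans hCm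
      _ ≤ (η / 3) ^ p.toReal := ENNReal.mul_div_le
  have b₃ : lpSize p (fun z : X × X => B / r * edist z.1 z.2) γ ≤ η / 3 := by
    have : lpSize p (fun z : X × X => B / r * edist z.1 z.2) γ ≤ B / r * δ := by
      rw [lpSize_le_iff]
      simp only [ENNReal.mul_rpow_of_nonneg _ _ hq.le]
      rw [lintegral_const_mul' _ _ (ENNReal.rpow_ne_top_of_nonneg hq.le hBr0)]
      gcongr
      exact lpSize_le_iff.1 hγδ
    refine this.trans ?_
    calc (B / r * δ : ℝ≥0∞) ≤ B / r * (η / 3 / (B / r)) := by gcongr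
      _ ≤ η / 3 := ENNReal.mul_div_le
  calc _ ≤ η / 3 + η / 3 + η / 3 := add_le_add (add_le_add b₁ b₂) b₃
    _ = η := ENNReal.add_thirds η

/-- If the second coordinate is a function of the first one, then the modulus of continuity
vanishes at zero: embed the space of values isometrically into a Banach space and approximate the
function in `L^p` by bounded continuous functions. -/
theorem exists_modulus_le_of_ae_eq [CompleteSpace X] (P : PSpace p (WithLp p (X × Y))) {g : X → Y}
    (hg : Measurable g) (hP : ∀ᵐ w ∂P.toMeasure, w.snd = g w.fst) {η : ℝ≥0∞} (hη : 0 < η) :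
    ∃ δ : ℝ≥0, 0 < δ ∧ modulus P δ ≤ η := by
  have hq := toReal_pos_of_fact p
  have hp0 : p ≠ 0 := (zero_lt_one.trans_le (Fact.out : 1 ≤ p)).ne'
  have hpt : p ≠ ∞ := Fact.out
  have hη3 : 0 < η / 3 := ENNReal.div_pos hη.ne' (by simp)
  obtain ⟨w₀⟩ := P.1.nonempty
  let m : Measure X := P.toMeasure.map fun w => w.fst
  have hm : IsProbabilityMeasure m :=
    Measure.isProbabilityMeasure_map WithLp.measurable_fst.aemeasurable
  let e := kuratowskiEmbedding Y
  have he : Isometry e := kuratowskiEmbedding.isometry Y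
  let G : X → lp (fun _ : ℕ => ℝ) ∞ := fun x => e (g x) - e w₀.snd
  have hG : ∀ x, ‖G x‖ₑ = edist (g x) w₀.snd := fun x => by
    rw [← edist_eq_enorm_sub, he.edist_eq]
  have hGm : MemLp G p m := by
    refine ⟨((he.continuous.comp_stronglyMeasurable hg.stronglyMeasurable).sub
      stronglyMeasurable_const).aestronglyMeasurable, ?_⟩
    rw [eLpNorm_eq_lintegral_rpow_enorm_toReal hp0 hpt]
    refine ENNReal.rpow_lt_top_of_nonneg (by positivity) (ne_of_lt ?_)
    simp only [hG]
    rw [lintegral_map (by fun_prop) WithLp.measurable_fst]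
    refine lt_of_le_of_lt ?_ (PSpace.lintegral_edist_rpow_lt_top w₀ P)
    refine lintegral_mono_ae ?_
    filter_upwards [hP] with w hw
    rw [← hw, edist_comm]
    gcongr
    exact WithLp.edist_snd_le_edist _ _
  obtain ⟨h, hh, -⟩ := hGm.exists_boundedContinuous_eLpNorm_sub_le hpt hη3.ne'
  rw [eLpNorm_eq_lintegral_rpow_enorm_toReal hp0 hpt] at hh
  have hh' : lpSize p (fun x => ‖G x - h x‖ₑ) m ≤ η / 3 := hh
  have hdm : AEMeasurable (fun x => ‖G x - h x‖ₑ) m :=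
    (hGm.1.sub h.continuous.aestronglyMeasurable).enorm
  obtain ⟨δ, hδ, hδh⟩ := exists_forall_lpSize_edist_le (p := p) m h hη3
  refine ⟨δ, hδ, iSup₂_le fun γ ⟨hγ1, hγ₁, hγ₂, hγδ⟩ => ?_⟩
  have hm₁ : γ.map (fun z => z.1.fst) ≤ m := by
    have := Measure.map_mono hγ₁ (WithLp.measurable_fst (p := p) (X := X) (Y := Y))
    rwa [Measure.map_map (by fun_prop) (by fun_prop)] at this
  have hm₂ : γ.map (fun z => z.2.fst) ≤ m := by
    have := Measure.map_mono hγ₂ (WithLp.measurable_fst (p := p) (X := X) (Y := Y))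
    rwa [Measure.map_map (by fun_prop) (by fun_prop)] at this
  have ae₁ : ∀ᵐ z ∂γ, z.1.snd = g z.1.fst :=
    ae_of_ae_map measurable_fst.aemeasurable (ae_mono hγ₁ hP)
  have ae₂ : ∀ᵐ z ∂γ, z.2.snd = g z.2.fst :=
    ae_of_ae_map measurable_snd.aemeasurable (ae_mono hγ₂ hP)
  have d₁ : AEMeasurable (fun z : WithLp p (X × Y) × WithLp p (X × Y) =>
      ‖G z.1.fst - h z.1.fst‖ₑ) γ := (hdm.mono_measure hm₁).comp_aemeasurable (by fun_prop)
  have d₂ : AEMeasurable (fun z : WithLp p (X × Y) × WithLp p (X × Y) =>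
      ‖G z.2.fst - h z.2.fst‖ₑ) γ := (hdm.mono_measure hm₂).comp_aemeasurable (by fun_prop)
  have l₁ : lpSize p (fun z => ‖G z.1.fst - h z.1.fst‖ₑ) γ ≤ η / 3 := by
    refine le_trans (le_of_eq ?_) ((lpSize_mono_measure hm₁).trans hh')
    unfold lpSize
    rw [lintegral_map' ((hdm.mono_measure hm₁).pow_const _) (by fun_prop)]
  have l₂ : lpSize p (fun z => ‖G z.2.fst - h z.2.fst‖ₑ) γ ≤ η / 3 := by
    refine le_trans (le_of_eq ?_) ((lpSize_mono_measure hm₂).trans hh')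
    unfold lpSize
    rw [lintegral_map' ((hdm.mono_measure hm₂).pow_const _) (by fun_prop)]
  have hhm : Measurable fun z : X × X => edist (h z.1) (h z.2) :=
    (by fun_prop : Continuous fun z : X × X => edist (h z.1) (h z.2)).measurable
  have l₃ : lpSize p (fun z : WithLp p (X × Y) × WithLp p (X × Y) =>
      edist (h z.1.fst) (h z.2.fst)) γ ≤ η / 3 := by
    have hmap := hδh (γ.map fun z => (z.1.fst, z.2.fst)) ?_ ?_ ?_
    · rwa [lpSize_map hhm (by fun_prop)] at hmap
    · rwa [Measure.map_apply (by fun_prop) MeasurableSet.univ]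
    · rwa [Measure.map_map (by fun_prop) (by fun_prop)]
    · rw [lpSize_map (by fun_prop) (by fun_prop)]
      exact hγδ
  calc shiftSnd p γ
      ≤ lpSize p (fun z => ‖G z.1.fst - h z.1.fst‖ₑ + edist (h z.1.fst) (h z.2.fst) +
          ‖G z.2.fst - h z.2.fst‖ₑ) γ := by
        refine lpSize_mono_ae ?_
        filter_upwards [ae₁, ae₂] with z h₁ h₂
        rw [h₁, h₂, ← he.edist_eq, ← edist_sub_right _ _ (e w₀.snd), ← edist_eq_enorm_sub,
          ← edist_eq_enorm_sub, edist_comm (G z.2.fst)]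
        exact edist_triangle4 _ _ _ _
    _ ≤ η / 3 + η / 3 + η / 3 :=
        (lpSize_add_three_le d₁ (hhm.comp (by fun_prop : Measurable fun z : WithLp p (X × Y) ×
          WithLp p (X × Y) => (z.1.fst, z.2.fst))).aemeasurable d₂).trans
          (add_le_add (add_le_add l₁ l₃) l₂)
    _ = η := ENNReal.add_thirds η

/-- If the modulus of continuity vanishes at zero, then the second coordinate is determined by the
first one: two copies of it which are conditionally independent given the first one coincide. -/
theorem ae_ae_ae_eq_of_modulus_zero [Nonempty Y] {P : PSpace p (WithLp p (X × Y))}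
    (hP : modulus P 0 = 0) :
    ∀ᵐ x ∂P.toMeasure.map (fun w => w.fst),
      ∀ᵐ y ∂condDistrib (fun w : WithLp p (X × Y) => w.snd) (fun w => w.fst) P.toMeasure x,
      ∀ᵐ y' ∂condDistrib (fun w : WithLp p (X × Y) => w.snd) (fun w => w.fst) P.toMeasure x,
        y = y' := by
  have hq := toReal_pos_of_fact p
  set m : Measure X := P.toMeasure.map fun w => w.fst with hm
  set κ := condDistrib (fun w : WithLp p (X × Y) => w.snd) (fun w => w.fst) P.toMeasure with hκ
  have hmp : IsProbabilityMeasure m :=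
    Measure.isProbabilityMeasure_map WithLp.measurable_fst.aemeasurable
  have hdis : m ⊗ₘ κ = P.toMeasure.map fun w => (w.fst, w.snd) :=
    compProd_map_condDistrib WithLp.measurable_snd.aemeasurable
  let γ₀ : Measure (X × Y × Y) := m ⊗ₘ (κ ×ₖ κ)
  have h₁ : γ₀.map (fun z => (z.1, z.2.1)) = m ⊗ₘ κ := by
    ext s hs
    rw [Measure.map_apply (by fun_prop) hs, Measure.compProd_apply (by measurability),
      Measure.compProd_apply hs]
    refine lintegral_congr fun x => ?_
    rw [Kernel.prod_apply]
    have : Prod.mk x ⁻¹' ((fun z : X × Y × Y => (z.1, z.2.1)) ⁻¹' s) =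
      (Prod.mk x ⁻¹' s) ×ˢ univ := by ext; simp
    rw [this, Measure.prod_prod, measure_univ, mul_one]
  have h₂ : γ₀.map (fun z => (z.1, z.2.2)) = m ⊗ₘ κ := by
    ext s hs
    rw [Measure.map_apply (by fun_prop) hs, Measure.compProd_apply (by measurability),
      Measure.compProd_apply hs]
    refine lintegral_congr fun x => ?_
    rw [Kernel.prod_apply]
    have : Prod.mk x ⁻¹' ((fun z : X × Y × Y => (z.1, z.2.2)) ⁻¹' s) =
      univ ×ˢ (Prod.mk x ⁻¹' s) := by ext; simp
    rw [this, Measure.prod_prod, measure_univ, one_mul]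
  have hback : (m ⊗ₘ κ).map (WithLp.toLp p) = P.toMeasure := by
    rw [hdis, Measure.map_map (by fun_prop) (by fun_prop)]
    exact Measure.map_id
  let f : X × Y × Y → WithLp p (X × Y) × WithLp p (X × Y) := fun z =>
    (WithLp.toLp p (z.1, z.2.1), WithLp.toLp p (z.1, z.2.2))
  have hf : Measurable f := by fun_prop
  have hmem : γ₀.map f ∈ shifts P 0 := by
    refine ⟨?_, ?_, ?_, ?_⟩
    · rw [Measure.map_apply hf MeasurableSet.univ]
      exact prob_le_one
    · rw [Measure.map_map (by fun_prop) hf, ← hback, ← h₁, Measure.map_map (by fun_prop) (by fun_prop)]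
      rfl
    · rw [Measure.map_map (by fun_prop) hf, ← hback, ← h₂, Measure.map_map (by fun_prop) (by fun_prop)]
      rfl
    · change lpSize p _ _ ≤ _
      rw [lpSize_map (by fun_prop) hf]
      simp [f, lpSize, hq]
  have hzero : ∫⁻ z, edist z.2.1 z.2.2 ^ p.toReal ∂γ₀ = 0 := by
    have h0 : lpSize p (fun z => edist z.1.snd z.2.snd) (γ₀.map f) ≤ 0 := by
      rw [← hP]
      exact le_iSup₂_of_le (γ₀.map f) hmem le_rfl
    rw [lpSize_map (by fun_prop) hf, lpSize_le_iff, ENNReal.zero_rpow_of_pos hq,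
      nonpos_iff_eq_zero] at h0
    exact h0
  rw [lintegral_eq_zero_iff (by fun_prop)] at hzero
  have hae : ∀ᵐ z ∂γ₀, z.2.1 = z.2.2 := by
    filter_upwards [hzero] with z hz
    simpa [hq, hq.not_gt] using hz
  filter_upwards [Measure.ae_ae_of_ae_compProd hae] with x hx
  rw [Kernel.prod_apply] at hx
  exact Measure.ae_ae_of_ae_prod hx

end ModulusOfContinuity

/-! ### The intensity of a law on pasts and conditional laws -/

section Information

variable {N : ℕ} {p : ℝ≥0∞} {Z : Fin N → Type*}

/-- The point whose first `t` coordinates are `x` and whose other coordinates are `y`. -/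
def concat (t : ℕ) (x : Past p Z t) (y : Future p Z t) : PiLp p Z :=
  WithLp.toLp p fun i => if h : i.val < t then x ⟨i, h⟩ else y ⟨i, not_lt.1 h⟩

theorem concat_past_future (t : ℕ) (z : PiLp p Z) : concat t (past t z) (future t z) = z := by
  ext i
  simp only [concat, past, future]
  split_ifs <;> rfl

theorem past_concat (t : ℕ) (x : Past p Z t) (y : Future p Z t) : past t (concat t x y) = x := by
  ext i
  simp only [concat, past, dif_pos i.2]

theorem future_concat (t : ℕ) (x : Past p Z t) (y : Future p Z t) :
    future t (concat t x y) = y := by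
  ext i
  simp only [concat, future, dif_neg (not_lt.2 i.2)]

variable [Fact (1 ≤ p)] [Fact (p ≠ ∞)] [∀ i, MetricSpace (Z i)] [∀ i, CompleteSpace (Z i)]
  [∀ i, SecondCountableTopology (Z i)] [∀ i, MeasurableSpace (Z i)] [∀ i, BorelSpace (Z i)]
  [∀ i, Nonempty (Z i)]

theorem edist_rpow_eq_past_add_future (t : ℕ) (w z : PiLp p Z) :
    edist w z ^ p.toReal = edist (past t w) (past t z) ^ p.toReal +
      edist (future t w) (future t z) ^ p.toReal := by
  have hq := toReal_pos_of_fact p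
  rw [PiLp.edist_eq_sum hq, PiLp.edist_eq_sum hq, PiLp.edist_eq_sum hq]
  simp only [← ENNReal.rpow_mul, one_div_mul_cancel hq.ne', ENNReal.rpow_one]
  rw [← Finset.sum_filter_add_sum_filter_not Finset.univ (fun i : Fin N => i.val < t)]
  congr 1
  · exact Finset.sum_subtype _ (by simp) (fun i => edist (w i) (z i) ^ p.toReal)
  · exact Finset.sum_subtype _ (by simp) (fun i => edist (w i) (z i) ^ p.toReal)

theorem lipschitzWith_past (t : ℕ) : LipschitzWith 1 (past (p := p) (Z := Z) t) := fun w z => by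
  rw [ENNReal.coe_one, one_mul]
  exact edist_restrict_le (toReal_pos_of_fact p) (fun i => i.val < t) w z

theorem lipschitzWith_future (t : ℕ) : LipschitzWith 1 (future (p := p) (Z := Z) t) :=
  fun w z => by
    rw [ENNReal.coe_one, one_mul]
    exact edist_restrict_le (toReal_pos_of_fact p) (fun i => t ≤ i.val) w z

theorem continuous_concat (t : ℕ) :
    Continuous fun z : Past p Z t × Future p Z t => concat t z.1 z.2 := by
  refine (PiLp.continuous_toLp p Z).comp (continuous_pi fun i => ?_)
  by_cases h : i.val < t
  · simp only [dif_pos h]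
    fun_prop
  · simp only [dif_neg h]
    fun_prop

instance borelSpacePastAndLaw (t : ℕ) :
    BorelSpace (WithLp p (Past p Z t × PSpace p (Future p Z t))) :=
  WithLp.borelSpace p _ _

instance secondCountableTopologyPastAndLaw (t : ℕ) :
    SecondCountableTopology (WithLp p (Past p Z t × PSpace p (Future p Z t))) :=
  inferInstance

instance nonemptyPiLp : Nonempty (PiLp p Z) :=
  (WithLp.equiv p _).nonempty

/-- The law of the concatenation of the point `w.fst` with a random future distributed according to
`w.snd`. -/
def concatLaw (t : ℕ) (w : WithLp p (Past p Z t × PSpace p (Future p Z t))) :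
    ProbabilityMeasure (PiLp p Z) :=
  ((diracProba w.fst).prod w.snd.1).map (continuous_concat t).measurable.aemeasurable

theorem continuous_concatLaw (t : ℕ) : Continuous (concatLaw (p := p) (Z := Z) t) := by
  have h1 : Continuous fun w : WithLp p (Past p Z t × PSpace p (Future p Z t)) =>
      diracProba w.fst := continuous_diracProba.comp (continuous_fst.comp (WithLp.prod_continuous_ofLp p _ _))
  have h2 : Continuous fun w : WithLp p (Past p Z t × PSpace p (Future p Z t)) => w.snd.1 :=
    PSpace.continuous_val.comp (continuous_snd.comp (WithLp.prod_continuous_ofLp p _ _))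
  exact (ProbabilityMeasure.continuous_map (continuous_concat t)).comp
    (ProbabilityMeasure.continuous_prod.comp (h1.prodMk h2))

theorem lintegral_concatLaw (t : ℕ) (w : WithLp p (Past p Z t × PSpace p (Future p Z t)))
    {f : PiLp p Z → ℝ≥0∞} (hf : Measurable f) :
    ∫⁻ z, f z ∂(concatLaw t w : Measure (PiLp p Z)) =
      ∫⁻ y, f (concat t w.fst y) ∂w.snd.toMeasure := by
  have hc := (continuous_concat (p := p) (Z := Z) t).measurable
  change ∫⁻ z, f z ∂(((Measure.dirac w.fst).prod w.snd.toMeasure).map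
    fun z => concat t z.1 z.2) = _
  have hfc : Measurable fun z : Past p Z t × Future p Z t => f (concat t z.1 z.2) := hf.comp hc
  rw [lintegral_map hf hc, lintegral_prod _ hfc.aemeasurable,
    lintegral_dirac' _ hfc.lintegral_prod_right']

theorem measurable_concatLaw (t : ℕ) :
    Measurable fun w => (concatLaw (p := p) (Z := Z) t w : Measure (PiLp p Z)) :=
  measurable_subtype_coe.comp (continuous_concatLaw t).measurable

theorem lintegral_bind_concatLaw (t : ℕ)
    (P : Measure (WithLp p (Past p Z t × PSpace p (Future p Z t))))
    {f : PiLp p Z → ℝ≥0∞} (hf : Measurable f) :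
    ∫⁻ z, f z ∂(P.bind fun w => (concatLaw t w : Measure (PiLp p Z))) =
      ∫⁻ w, ∫⁻ y, f (concat t w.fst y) ∂w.snd.toMeasure ∂P := by
  rw [Measure.lintegral_bind (measurable_concatLaw t).aemeasurable hf.aemeasurable]
  exact lintegral_congr fun w => lintegral_concatLaw t w hf

theorem lintegral_edist_rpow_bind_concatLaw (t : ℕ)
    (P : Measure (WithLp p (Past p Z t × PSpace p (Future p Z t)))) (z₀ : PiLp p Z) :
    ∫⁻ z, edist z₀ z ^ p.toReal ∂(P.bind fun w => (concatLaw t w : Measure (PiLp p Z))) =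
      ∫⁻ w, edist (WithLp.toLp p (past t z₀, PSpace.dirac p (future t z₀))) w ^ p.toReal ∂P := by
  rw [lintegral_bind_concatLaw t P (by fun_prop)]
  refine lintegral_congr fun w => ?_
  simp only [edist_rpow_eq_past_add_future t z₀, past_concat, future_concat]
  rw [lintegral_add_left measurable_const, lintegral_const, measure_univ, mul_one,
    WithLp.edist_rpow_eq_add]
  simp only [WithLp.toLp_fst, WithLp.toLp_snd, PSpace.edist_dirac_rpow]

/-- The intensity of a law `P` of a random past and a random law of the future: first draw a past
and a law according to `P`, then a future according to this law. -/
def intensity (t : ℕ) (P : PSpace p (WithLp p (Past p Z t × PSpace p (Future p Z t)))) :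
    PSpace p (PiLp p Z) :=
  ⟨⟨P.toMeasure.bind fun w => (concatLaw t w : Measure (PiLp p Z)),
    isProbabilityMeasure_bind (measurable_concatLaw t).aemeasurable
      (ae_of_all _ fun w => inferInstance)⟩, by
    refine ⟨Classical.arbitrary _, ?_⟩
    rw [ProbabilityMeasure.coe_mk, lintegral_edist_rpow_bind_concatLaw]
    exact PSpace.lintegral_edist_rpow_lt_top _ P⟩

theorem lintegral_intensity (t : ℕ)
    (P : PSpace p (WithLp p (Past p Z t × PSpace p (Future p Z t))))
    {f : PiLp p Z → ℝ≥0∞} (hf : Measurable f) :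
    ∫⁻ z, f z ∂(intensity t P).toMeasure =
      ∫⁻ w, ∫⁻ y, f (concat t w.fst y) ∂w.snd.toMeasure ∂P.toMeasure :=
  lintegral_bind_concatLaw t P.toMeasure hf

theorem continuous_intensity (t : ℕ) : Continuous (intensity (p := p) (Z := Z) t) := by
  rw [continuous_iff_continuousAt]
  intro P
  let z₀ : PiLp p Z := Classical.arbitrary _
  refine (PSpace.tendsto_nhds_iff z₀).2 ⟨?_, ?_⟩
  · refine ProbabilityMeasure.tendsto_iff_forall_lintegral_tendsto.2 fun f => ?_
    have hfm : Measurable fun z => (f z : ℝ≥0∞) := by fun_prop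
    let F : WithLp p (Past p Z t × PSpace p (Future p Z t)) → ℝ≥0∞ := fun w =>
      ∫⁻ z, f z ∂(concatLaw t w : Measure (PiLp p Z))
    have hF : Continuous F :=
      ProbabilityMeasure.continuous_iff_forall_continuous_lintegral.1 (continuous_concatLaw t) f
    obtain ⟨M, hM⟩ : ∃ M : ℝ≥0, ∀ w, F w ≤ M := by
      refine ⟨nndist f 0, fun w => ?_⟩
      calc F w ≤ ∫⁻ _, (nndist f 0 : ℝ≥0∞) ∂(concatLaw t w : Measure (PiLp p Z)) :=
            lintegral_mono fun z => ENNReal.coe_le_coe.2 <| BoundedContinuousFunction.NNReal.upper_bound f z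
        _ = nndist f 0 := by rw [lintegral_const, measure_univ, mul_one]
    have h := PSpace.tendsto_lintegral_min_of_tendsto
      ((PSpace.continuous_val (p := p)).tendsto P) hF M
    simp only [min_eq_left (hM _)] at h
    have e : ∀ Q : PSpace p (WithLp p (Past p Z t × PSpace p (Future p Z t))),
        ∫⁻ z, f z ∂(intensity t Q).toMeasure = ∫⁻ w, F w ∂Q.toMeasure := fun Q => by
      rw [lintegral_intensity t Q hfm]
      exact lintegral_congr fun w => (lintegral_concatLaw t w hfm).symm
    refine Tendsto.congr (fun Q => (e Q).symm) ?_
    change Tendsto _ _ (𝓝 (∫⁻ z, f z ∂(intensity t P).toMeasure))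
    rw [e P]
    exact h
  · have e : ∀ Q : PSpace p (WithLp p (Past p Z t × PSpace p (Future p Z t))),
        ∫⁻ z, edist z₀ z ^ p.toReal ∂(intensity t Q).toMeasure = ∫⁻ w, edist (WithLp.toLp p
          (past t z₀, PSpace.dirac p (future t z₀))) w ^ p.toReal ∂Q.toMeasure := fun Q =>
      lintegral_edist_rpow_bind_concatLaw t Q.toMeasure z₀
    refine Tendsto.congr (fun Q => (e Q).symm) ?_
    change Tendsto _ _ (𝓝 (∫⁻ z, edist z₀ z ^ p.toReal ∂(intensity t P).toMeasure))
    rw [e P]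
    exact ((PSpace.tendsto_nhds_iff _).1 tendsto_id).2

theorem ae_toMeasure_condLaw (t : ℕ) (μ : PSpace p (PiLp p Z)) :
    ∀ᵐ x ∂μ.toMeasure.map (past t),
      (condLaw t μ x).toMeasure = condDistrib (future t) (past t) μ.toMeasure x := by
  let w : PiLp p Z := Classical.arbitrary _
  set κ := condDistrib (future t) (past t) μ.toMeasure
  have hf : Measurable fun y : Future p Z t => edist (future t w) y ^ p.toReal := by fun_prop
  have hint : ∫⁻ x, ∫⁻ y, edist (future t w) y ^ p.toReal ∂(κ x) ∂μ.toMeasure.map (past t) < ∞ := by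
    rw [← Measure.lintegral_bind κ.aemeasurable hf.aemeasurable,
      condDistrib_comp_map (measurable_past t).aemeasurable (measurable_future t).aemeasurable,
      lintegral_map hf (measurable_future t)]
    refine lt_of_le_of_lt (lintegral_mono fun z => ?_) (PSpace.lintegral_edist_rpow_lt_top w μ)
    rw [edist_rpow_eq_past_add_future t w z]
    exact le_add_self
  filter_upwards [ae_lt_top hf.lintegral_kernel hint.ne] with x hx
  exact toMeasure_condLaw_of_pos ⟨_, hx⟩

theorem lintegral_infoMap (t : ℕ) (μ : PSpace p (PiLp p Z))
    {f : Past p Z t → PSpace p (Future p Z t) → ℝ≥0∞}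
    (hf : Measurable fun w : Past p Z t × PSpace p (Future p Z t) => f w.1 w.2) :
    ∫⁻ w, f w.fst w.snd ∂(infoMap t μ).toMeasure =
      ∫⁻ x, f x (condLaw t μ x) ∂μ.toMeasure.map (past t) := by
  change ∫⁻ w, f w.fst w.snd ∂μ.toMeasure.map (pastAndCondLaw t μ) = _
  have hf' : Measurable fun w : WithLp p (Past p Z t × PSpace p (Future p Z t)) =>
    f w.fst w.snd := hf.comp (WithLp.measurable_ofLp p _)
  rw [lintegral_map hf' (measurable_pastAndCondLaw t μ), lintegral_map _ (measurable_past t)]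
  · rfl
  · exact hf.comp (measurable_id.prodMk (measurable_condLaw t μ))

/-- The integral of a function against the intensity of `ℐ_t(μ)` is obtained by disintegrating
`μ`. -/
theorem lintegral_infoMap_lintegral (t : ℕ) (μ : PSpace p (PiLp p Z))
    {f : Past p Z t × Future p Z t → ℝ≥0∞} (hf : Measurable f) :
    ∫⁻ w, ∫⁻ y, f (w.fst, y) ∂w.snd.toMeasure ∂(infoMap t μ).toMeasure =
      ∫⁻ z, f (past t z, future t z) ∂μ.toMeasure := by
  let η : Kernel (PSpace p (Future p Z t)) (Future p Z t) :=
    ⟨PSpace.toMeasure, PSpace.measurable_toMeasure⟩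
  have : IsMarkovKernel η := ⟨fun q => inferInstanceAs (IsProbabilityMeasure q.toMeasure)⟩
  have hm : Measurable fun w : Past p Z t × PSpace p (Future p Z t) =>
      ∫⁻ y, f (w.1, y) ∂w.2.toMeasure := by
    have := Measurable.lintegral_kernel_prod_right' (κ := η.comap Prod.snd measurable_snd)
      (f := fun z : (Past p Z t × PSpace p (Future p Z t)) × Future p Z t => f (z.1.1, z.2))
      (hf.comp (by fun_prop))
    exact this
  rw [lintegral_infoMap t μ (f := fun x q => ∫⁻ y, f (x, y) ∂q.toMeasure) hm]
  calc ∫⁻ x, ∫⁻ y, f (x, y) ∂(condLaw t μ x).toMeasure ∂μ.toMeasure.map (past t)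
      = ∫⁻ x, ∫⁻ y, f (x, y) ∂(condDistrib (future t) (past t) μ.toMeasure x)
          ∂μ.toMeasure.map (past t) := by
        refine lintegral_congr_ae ?_
        filter_upwards [ae_toMeasure_condLaw t μ] with x hx
        rw [hx]
    _ = ∫⁻ z, f z ∂((μ.toMeasure.map (past t)) ⊗ₘ
          condDistrib (future t) (past t) μ.toMeasure) := (Measure.lintegral_compProd hf).symm
    _ = _ := by
        rw [compProd_map_condDistrib (measurable_future t).aemeasurable,
          lintegral_map hf ((measurable_past t).prodMk (measurable_future t))]

theorem intensity_infoMap (t : ℕ) (μ : PSpace p (PiLp p Z)) : intensity t (infoMap t μ) = μ := by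
  refine PSpace.ext (Measure.ext_of_lintegral _ fun f hf => ?_)
  rw [lintegral_intensity t _ hf, lintegral_infoMap_lintegral t μ
    (f := fun z => f (concat t z.1 z.2)) (hf.comp (continuous_concat t).measurable)]
  simp only [concat_past_future]

theorem map_past_intensity (t : ℕ)
    (P : PSpace p (WithLp p (Past p Z t × PSpace p (Future p Z t)))) :
    (intensity t P).toMeasure.map (past t) = P.toMeasure.map fun w => w.fst := by
  refine Measure.ext_of_lintegral _ fun f hf => ?_
  rw [lintegral_map hf (measurable_past t), lintegral_map hf WithLp.measurable_fst,
    lintegral_intensity t P (f := fun z => f (past t z)) (hf.comp (measurable_past t))]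
  simp [past_concat]

/-- A law with vanishing modulus of continuity at zero is the law of a past and the conditional law
of the future given the past. -/
theorem infoMap_intensity_of_modulus_zero (t : ℕ)
    {P : PSpace p (WithLp p (Past p Z t × PSpace p (Future p Z t)))} (hP : modulus P 0 = 0) :
    infoMap t (intensity t P) = P := by
  have hne : Nonempty (PSpace p (Future p Z t)) := ⟨PSpace.dirac p (Classical.arbitrary _)⟩
  set m := P.toMeasure.map fun w => w.fst with hm
  set κ := condDistrib (fun w : WithLp p (Past p Z t × PSpace p (Future p Z t)) => w.snd)
    (fun w => w.fst) P.toMeasure with hκ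
  set ν := intensity t P with hν
  let η : Kernel (PSpace p (Future p Z t)) (Future p Z t) :=
    ⟨PSpace.toMeasure, PSpace.measurable_toMeasure⟩
  have hη : IsMarkovKernel η := ⟨fun q => inferInstanceAs (IsProbabilityMeasure q.toMeasure)⟩
  have hmp : IsProbabilityMeasure m :=
    Measure.isProbabilityMeasure_map WithLp.measurable_fst.aemeasurable
  have hdis : m ⊗ₘ κ = P.toMeasure.map fun w => (w.fst, w.snd) :=
    compProd_map_condDistrib WithLp.measurable_snd.aemeasurable
  -- the conditional law of the future given the past under `ν` is the mean of the conditional law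
  -- `κ` of the second coordinate under `P`
  have hjoint : ν.toMeasure.map (fun z => (past t z, future t z)) =
      ν.toMeasure.map (past t) ⊗ₘ (η ∘ₖ κ) := by
    refine Measure.ext_of_lintegral _ fun f hf => ?_
    have hm' : Measurable fun w : Past p Z t × PSpace p (Future p Z t) =>
        ∫⁻ y, f (w.1, y) ∂w.2.toMeasure :=
      Measurable.lintegral_kernel_prod_right' (κ := η.comap Prod.snd measurable_snd)
        (f := fun z : (Past p Z t × PSpace p (Future p Z t)) × Future p Z t => f (z.1.1, z.2))
        (hf.comp (by fun_prop))
    have hpf := (measurable_past (p := p) (Z := Z) t).prodMk (measurable_future t)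
    rw [lintegral_map hf hpf, hν, lintegral_intensity t P
      (f := fun z => f (past t z, future t z)) (hf.comp hpf), map_past_intensity,
      Measure.lintegral_compProd hf]
    simp only [past_concat, future_concat]
    calc ∫⁻ w, ∫⁻ y, f (w.fst, y) ∂w.snd.toMeasure ∂P.toMeasure
        = ∫⁻ w, ∫⁻ y, f (w.1, y) ∂w.2.toMeasure ∂(m ⊗ₘ κ) := by
          rw [hdis, lintegral_map hm' (by fun_prop)]
      _ = ∫⁻ x, ∫⁻ q, ∫⁻ y, f (x, y) ∂q.toMeasure ∂κ x ∂m := Measure.lintegral_compProd hm'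
      _ = ∫⁻ x, ∫⁻ y, f (x, y) ∂(η ∘ₖ κ) x ∂m := by
          refine lintegral_congr fun x => ?_
          have hfx : Measurable fun y => f (x, y) := hf.comp measurable_prodMk_left
          rw [Kernel.lintegral_comp _ _ _ hfx]
          rfl
  have hcond := condDistrib_ae_eq_of_measure_eq_compProd (past t)
    (measurable_future t).aemeasurable hjoint
  rw [hν, map_past_intensity] at hcond
  -- as `κ x` is a point mass, it is the point mass at its mean
  have hae : ∀ᵐ x ∂m, ∀ᵐ q ∂κ x, condLaw t ν x = q := by
    filter_upwards [ae_ae_ae_eq_of_modulus_zero hP, hcond] with x hx hxc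
    filter_upwards [hx] with q hq
    have hcomp : (η ∘ₖ κ) x = q.toMeasure := by
      rw [Kernel.comp_apply]
      ext s hs
      rw [Measure.bind_apply hs η.aemeasurable]
      calc ∫⁻ q', η q' s ∂κ x = ∫⁻ _, q.toMeasure s ∂κ x := by
            refine lintegral_congr_ae ?_
            filter_upwards [hq] with q' hq'
            rw [hq']
            rfl
        _ = q.toMeasure s := by simp
    rw [hcomp] at hxc
    refine PSpace.ext ?_
    rw [toMeasure_condLaw_of_pos, hxc]
    rw [hxc]
    exact q.2
  have hPae : ∀ᵐ w ∂P.toMeasure, condLaw t ν w.fst = w.snd := by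
    have hset : MeasurableSet {z : Past p Z t × PSpace p (Future p Z t) |
        condLaw t ν z.1 = z.2} :=
      measurableSet_eq_fun ((measurable_condLaw t ν).comp measurable_fst) measurable_snd
    have := Measure.ae_compProd_of_ae_ae hset hae
    rw [hdis] at this
    exact ae_of_ae_map (by fun_prop) this
  refine PSpace.ext ?_
  have hg : Measurable fun x => (WithLp.toLp p (x, condLaw t ν x) :
      WithLp p (Past p Z t × PSpace p (Future p Z t))) :=
    (WithLp.measurable_toLp _ _).comp (measurable_id.prodMk (measurable_condLaw t ν))
  calc (infoMap t ν).toMeasure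
      = (ν.toMeasure.map (past t)).map fun x => WithLp.toLp p (x, condLaw t ν x) := by
        rw [Measure.map_map hg (measurable_past t)]
        rfl
    _ = P.toMeasure.map fun w => WithLp.toLp p (w.fst, condLaw t ν w.fst) := by
        rw [hν, map_past_intensity, Measure.map_map (hν ▸ hg) WithLp.measurable_fst]
        rfl
    _ = P.toMeasure.map id := by
        refine Measure.map_congr ?_
        filter_upwards [hPae] with w hw
        rw [hw]
        rfl
    _ = P.toMeasure := Measure.map_id

theorem ae_snd_infoMap (t : ℕ) (μ : PSpace p (PiLp p Z)) :
    ∀ᵐ w ∂(infoMap t μ).toMeasure, w.snd = condLaw t μ w.fst := by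
  change ∀ᵐ w ∂μ.toMeasure.map (pastAndCondLaw t μ), w.snd = condLaw t μ w.fst
  have hset : MeasurableSet {w : WithLp p (Past p Z t × PSpace p (Future p Z t)) |
      w.snd = condLaw t μ w.fst} :=
    measurableSet_eq_fun WithLp.measurable_snd
      ((measurable_condLaw t μ).comp WithLp.measurable_fst)
  exact (ae_map_iff (measurable_pastAndCondLaw t μ).aemeasurable hset).2 (ae_of_all _ fun _ => rfl)

end Information

/-! ### Uniformity of moduli of continuity -/

section Uniform

variable {p : ℝ≥0∞} [Fact (1 ≤ p)] [Fact (p ≠ ∞)]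
  {X : Type*} [MetricSpace X] [SecondCountableTopology X] [MeasurableSpace X] [BorelSpace X]
  [StandardBorelSpace X]
  {Y : Type*} [MetricSpace Y] [SecondCountableTopology Y] [MeasurableSpace Y] [BorelSpace Y]
  [StandardBorelSpace Y]

/-- A Dini argument: moduli of continuity which tend to zero at each point of a compact set do so
uniformly. -/
theorem IsCompact.exists_forall_modulus_le {L : Set (PSpace p (WithLp p (X × Y)))}
    (hL : IsCompact L) {η : ℝ≥0∞} (hη : 0 < η)
    (h : ∀ P ∈ L, ∀ η : ℝ≥0∞, 0 < η → ∃ δ : ℝ≥0, 0 < δ ∧ modulus P δ ≤ η) :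
    ∃ δ : ℝ≥0, 0 < δ ∧ ∀ P ∈ L, modulus P δ ≤ η := by
  obtain ⟨r, hr, hrη⟩ := ENNReal.lt_iff_exists_nnreal_btwn.1 hη
  have hr : 0 < r := by exact_mod_cast hr
  refine hL.induction_on (p := fun s => ∃ δ : ℝ≥0, 0 < δ ∧ ∀ P ∈ s, modulus P δ ≤ η)
    ⟨1, one_pos, by simp⟩ ?_ ?_ ?_
  · rintro s t hst ⟨δ, hδ, ht⟩
    exact ⟨δ, hδ, fun P hP => ht P (hst hP)⟩
  · rintro s t ⟨δ, hδ, hs⟩ ⟨δ', hδ', ht⟩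
    refine ⟨min δ δ', lt_min hδ hδ', ?_⟩
    rintro P (hP | hP)
    · exact (modulus_mono P (min_le_left _ _)).trans (hs P hP)
    · exact (modulus_mono P (min_le_right _ _)).trans (ht P hP)
  · intro P hP
    obtain ⟨δ, hδ, hPδ⟩ := h P hP (r / 2 : ℝ≥0) (by exact_mod_cast half_pos hr)
    let ε : ℝ≥0 := min (δ / 4) (r / 4)
    have hε : 0 < ε := lt_min (by positivity) (by positivity)
    have h1 : δ / 2 + 2 * ε ≤ δ := by
      have : ε ≤ δ / 4 := min_le_left _ _
      rw [← NNReal.coe_le_coe] at this ⊢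
      push_cast at this ⊢
      linarith
    have h2 : r / 2 + 2 * ε ≤ r := by
      have : ε ≤ r / 4 := min_le_right _ _
      rw [← NNReal.coe_le_coe] at this ⊢
      push_cast at this ⊢
      linarith
    refine ⟨{Q | edist Q P < ε}, mem_nhdsWithin_of_mem_nhds (Metric.eball_mem_nhds P
      (by exact_mod_cast hε)), δ / 2, half_pos hδ, fun Q hQ => ?_⟩
    calc modulus Q (δ / 2) ≤ modulus P (δ / 2 + 2 * ε) + 2 * ε := modulus_le_of_edist_lt hQ _
      _ ≤ (r / 2 : ℝ≥0) + 2 * ε := by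
          gcongr
          exact (modulus_mono P h1).trans hPδ
      _ ≤ r := by exact_mod_cast h2
      _ ≤ η := hrη.le

/-- Uniformly small moduli of continuity force the modulus of a limit to vanish at zero. -/
theorem modulus_zero_of_mem_closure {S : Set (PSpace p (WithLp p (X × Y)))}
    (h : ∀ η : ℝ≥0∞, 0 < η → ∃ δ : ℝ≥0, 0 < δ ∧ ∀ P ∈ S, modulus P δ ≤ η)
    {P : PSpace p (WithLp p (X × Y))} (hP : P ∈ closure S) : modulus P 0 = 0 := by
  by_contra hne
  obtain ⟨r, hr, hrP⟩ := ENNReal.lt_iff_exists_nnreal_btwn.1 (pos_iff_ne_zero.2 hne)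
  have hr : 0 < r := by exact_mod_cast hr
  obtain ⟨δ, hδ, hS⟩ := h (r / 2 : ℝ≥0) (by exact_mod_cast half_pos hr)
  let ε : ℝ≥0 := min (δ / 2) (r / 4)
  have hε : 0 < ε := lt_min (by positivity) (by positivity)
  have h1 : 0 + 2 * ε ≤ δ := by
    have : ε ≤ δ / 2 := min_le_left _ _
    rw [← NNReal.coe_le_coe] at this ⊢
    push_cast at this ⊢
    linarith
  have h2 : r / 2 + 2 * ε ≤ r := by
    have : ε ≤ r / 4 := min_le_right _ _
    rw [← NNReal.coe_le_coe] at this ⊢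
    push_cast at this ⊢
    linarith
  obtain ⟨Q, hQ, hPQ⟩ := EMetric.mem_closure_iff.1 hP ε (by exact_mod_cast hε)
  refine hrP.not_ge ?_
  calc modulus P 0 ≤ modulus Q (0 + 2 * ε) + 2 * ε := modulus_le_of_edist_lt hPQ _
    _ ≤ (r / 2 : ℝ≥0) + 2 * ε := by
        gcongr
        exact (modulus_mono Q h1).trans (hS Q hQ)
    _ ≤ r := by exact_mod_cast h2

theorem tendsto_iSup_modulus_iff {ι : Type*} {K : Set ι} {P : ι → PSpace p (WithLp p (X × Y))} :
    Tendsto (fun δ : ℝ≥0 => ⨆ i ∈ K, modulus (P i) δ) (𝓝[>] 0) (𝓝 0) ↔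
      ∀ η : ℝ≥0∞, 0 < η → ∃ δ : ℝ≥0, 0 < δ ∧ ∀ i ∈ K, modulus (P i) δ ≤ η := by
  rw [ENNReal.tendsto_nhds_zero]
  refine forall₂_congr fun η _ => ⟨fun h => ?_, fun ⟨δ, hδ, h⟩ => ?_⟩
  · obtain ⟨δ, h, hδ⟩ := (h.and self_mem_nhdsWithin).exists
    exact ⟨δ, hδ, iSup₂_le_iff.1 h⟩
  · filter_upwards [Ioo_mem_nhdsGT hδ] with δ' hδ'
    exact iSup₂_le fun i hi => (modulus_mono _ hδ'.2.le).trans (h i hi)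

end Uniform

/-! ### Compactness in the information topology -/

/-- A set is relatively compact for an induced topology if its image is relatively compact and the
limits of the image are attained. -/
theorem Topology.IsInducing.isCompact_closure {α β : Type*} [TopologicalSpace α]
    [TopologicalSpace β] {I : α → β} (hI : IsInducing I) {K : Set α}
    (hc : IsCompact (closure (I '' K))) (hr : closure (I '' K) ⊆ range I) :
    IsCompact (closure K) := by
  rw [hI.closure_eq_preimage_closure_image]
  exact hI.isCompact_preimage' hc hr

section Information

variable {N : ℕ} {p : ℝ≥0∞} {Z : Fin N → Type*}
  [Fact (1 ≤ p)] [∀ i, MetricSpace (Z i)] [∀ i, CompleteSpace (Z i)]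
  [∀ i, SecondCountableTopology (Z i)] [∀ i, MeasurableSpace (Z i)] [∀ i, BorelSpace (Z i)]
  [∀ i, Nonempty (Z i)]

/-- The information topology is induced by the joint map `(ℐ_t)_{1 ≤ t < N}`. -/
theorem isInducing_infoMap : @IsInducing (PSpace p (PiLp p Z))
    ((t : Ico 1 N) → PSpace p (WithLp p (Past p Z t × PSpace p (Future p Z t))))
    (infoTopology p Z) _ fun μ t => infoMap t μ := by
  refine @IsInducing.mk _ _ (infoTopology p Z) _ _ ?_
  rw [induced_to_pi, infoTopology, iInf_subtype']

theorem continuous_infoMap {t : ℕ} (ht : t ∈ Ico 1 N) :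
    @Continuous _ _ (infoTopology p Z) _ (infoMap (p := p) (Z := Z) t) :=
  continuous_iff_le_induced.2 (iInf₂_le t ht)

variable [Fact (p ≠ ∞)]

/-- The information topology is finer than the Wasserstein topology, since the intensity map is a
continuous left inverse of `ℐ_t`. -/
theorem infoTopology_le (hN : 2 ≤ N) :
    infoTopology p Z ≤ (inferInstance : TopologicalSpace (PSpace p (PiLp p Z))) := by
  have h := @Continuous.comp _ _ _ (infoTopology p Z) _ _ _ _
    (continuous_intensity (p := p) (Z := Z) 1) (continuous_infoMap (p := p) (Z := Z) (t := 1) ⟨le_rfl, hN⟩)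
  have hid : intensity 1 ∘ infoMap (p := p) (Z := Z) 1 = id := funext (intensity_infoMap 1)
  rw [hid] at h
  exact continuous_id_iff_le.1 h

theorem isCompact_closure_image_infoMap (t : ℕ) {K : Set (PSpace p (PiLp p Z))}
    (hK : IsCompact (closure K)) : IsCompact (closure (infoMap t '' K)) := by
  let z₀ : PiLp p Z := Classical.arbitrary _
  obtain ⟨Φ, hΦ, R, hR⟩ := PSpace.exists_isMomentCoercive hK (lipschitzWith_past t) z₀
  obtain ⟨Ψ, hΨ, S, hS⟩ := PSpace.exists_isMomentCoercive hK (lipschitzWith_future t) z₀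
  refine (PSpace.isCompact_closure_of_isMomentCoercive (hΦ.prod hΨ.lintegral)
    (R + S)).closure_of_subset (Subset.trans ?_ subset_closure)
  rintro _ ⟨μ, hμ, rfl⟩
  have hf : Measurable fun z : Past p Z t × Future p Z t => Φ z.1 + Ψ z.2 :=
    (hΦ.measurable.comp measurable_fst).add (hΨ.measurable.comp measurable_snd)
  calc ∫⁻ w, (Φ w.fst + ∫⁻ y, Ψ y ∂w.snd.toMeasure) ∂(infoMap t μ).toMeasure
      = ∫⁻ w, ∫⁻ y, (Φ w.fst + Ψ y) ∂w.snd.toMeasure ∂(infoMap t μ).toMeasure := by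
        refine lintegral_congr fun w => ?_
        rw [lintegral_add_left measurable_const, lintegral_const, measure_univ, mul_one]
    _ = ∫⁻ z, (Φ (past t z) + Ψ (future t z)) ∂μ.toMeasure :=
        lintegral_infoMap_lintegral t μ hf
    _ = ∫⁻ z, Φ (past t z) ∂μ.toMeasure + ∫⁻ z, Ψ (future t z) ∂μ.toMeasure :=
        lintegral_add_left (hΦ.measurable.comp (measurable_past t)) _
    _ ≤ R + S := add_le_add (hR μ hμ) (hS μ hμ)
    _ = ((R + S : ℝ≥0) : ℝ≥0∞) := by push_cast; rfl

theorem exists_modulus_infoMap_le (t : ℕ) (μ : PSpace p (PiLp p Z)) {η : ℝ≥0∞} (hη : 0 < η) :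
    ∃ δ : ℝ≥0, 0 < δ ∧ modulus (infoMap t μ) δ ≤ η :=
  exists_modulus_le_of_ae_eq _ (measurable_condLaw t μ) (ae_snd_infoMap t μ) hη

/-- The limits of the joint image of `K` under the maps `ℐ_t` are attained if the moduli of
continuity are uniformly small on `K`: each component is the image under `ℐ_t` of its intensity, and
the intensities of the components agree. -/
theorem closure_image_infoMap_subset_range (hN : 2 ≤ N) {K : Set (PSpace p (PiLp p Z))}
    (h : ∀ t ∈ Ico 1 N, ∀ η : ℝ≥0∞, 0 < η →
      ∃ δ : ℝ≥0, 0 < δ ∧ ∀ μ ∈ K, modulus (infoMap t μ) δ ≤ η) :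
    closure ((fun μ (t : Ico 1 N) => infoMap (p := p) (Z := Z) t μ) '' K) ⊆
      range fun μ (t : Ico 1 N) => infoMap (p := p) (Z := Z) t μ := by
  intro P hP
  have hcl : ∀ t : Ico 1 N, P t ∈ closure (infoMap t '' K) := fun t =>
    map_mem_closure (continuous_apply t) hP (by rintro _ ⟨μ, hμ, rfl⟩; exact ⟨μ, hμ, rfl⟩)
  have hzero : ∀ t : Ico 1 N, modulus (P t) 0 = 0 := fun t =>
    modulus_zero_of_mem_closure (fun η hη => by simpa using h t t.2 η hη) (hcl t)
  let s : Ico 1 N := ⟨1, le_rfl, hN⟩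
  have heq : ∀ t : Ico 1 N, intensity t (P t) = intensity s (P s) := fun t => by
    have hclosed : IsClosed {Q : (t : Ico 1 N) → PSpace p (WithLp p (Past p Z t ×
        PSpace p (Future p Z t))) | intensity t (Q t) = intensity s (Q s)} :=
      isClosed_eq ((continuous_intensity _).comp (continuous_apply t))
        ((continuous_intensity _).comp (continuous_apply s))
    refine closure_minimal ?_ hclosed hP
    rintro _ ⟨μ, -, rfl⟩
    exact (intensity_infoMap _ μ).trans (intensity_infoMap _ μ).symm
  refine ⟨intensity s (P s), funext fun t => ?_⟩
  change infoMap t (intensity s (P s)) = P t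
  rw [← heq t]
  exact infoMap_intensity_of_modulus_zero _ (hzero t)

end Information

end

theorem mainTheorem1 (N : ℕ) (hN : 2 ≤ N) (p : ℝ≥0∞) [Fact (1 ≤ p)] (hp : p ≠ ∞)
    (Z : Fin N → Type*) [∀ i, MetricSpace (Z i)] [∀ i, CompleteSpace (Z i)]
    [∀ i, SecondCountableTopology (Z i)] [∀ i, MeasurableSpace (Z i)] [∀ i, BorelSpace (Z i)]
    [∀ i, Nonempty (Z i)] (K : Set (PSpace p (PiLp p Z))) :
    @IsCompact _ (infoTopology p Z) (@closure _ (infoTopology p Z) K) ↔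
      IsCompact (closure K) ∧
        ∀ t ∈ Ico 1 N,
          Tendsto (fun δ : ℝ≥0 => ⨆ μ ∈ K, modulus (infoMap t μ) δ) (𝓝[>] 0) (𝓝 0) := by
  have : Fact (p ≠ ∞) := ⟨hp⟩
  simp only [tendsto_iSup_modulus_iff]
  constructor
  · intro hC
    have hKC : K ⊆ @closure _ (infoTopology p Z) K := @subset_closure _ (infoTopology p Z) K
    refine ⟨?_, fun t ht η hη => ?_⟩
    · have hid : @Continuous _ _ (infoTopology p Z) _ (id : PSpace p (PiLp p Z) → _) :=
        continuous_id_iff_le.2 (infoTopology_le hN)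
      have := @IsCompact.image _ _ (infoTopology p Z) _ _ _ hC hid
      rw [image_id] at this
      exact this.closure_of_subset hKC
    · have hL := @IsCompact.image _ _ (infoTopology p Z) _ _ _ hC (continuous_infoMap ht)
      obtain ⟨δ, hδ, h⟩ := hL.exists_forall_modulus_le hη (by
        rintro _ ⟨μ, -, rfl⟩ η hη
        exact exists_modulus_infoMap_le t μ hη)
      exact ⟨δ, hδ, fun μ hμ => h _ ⟨μ, hKC hμ, rfl⟩⟩
  · rintro ⟨hK, hmod⟩
    refine @IsInducing.isCompact_closure _ _ (infoTopology p Z) _ _ isInducing_infoMap K ?_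
      (closure_image_infoMap_subset_range hN hmod)
    have hT2 (t : ℕ) : T2Space (PSpace p (WithLp p (Past p Z t × PSpace p (Future p Z t)))) := by
      let _ : MetricSpace (PSpace p (WithLp p (Past p Z t × PSpace p (Future p Z t)))) :=
        PSpace.instMetricSpace
      infer_instance
    refine (isCompact_univ_pi fun t : Ico 1 N =>
      isCompact_closure_image_infoMap (t : ℕ) hK).closure_of_subset ?_
    rintro _ ⟨μ, hμ, rfl⟩ t -
    exact subset_closure ⟨μ, hμ, rfl⟩
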